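/- **Model.** Let $T\ge 0$. A state-space model consists of latent states $X_0,\dots,X_T$, where $X_t$ takes values in a measurable space $E_t$, and of observations $Y_t=(Y_{t,1},\dots,Y_{t,m_t})\in\mathbb R^{m_t}$, $0\le t\le T$. $X_0$ has law $\mu_0$; the only parent of $X_{t+1}$ is $X_t$, with transition kernel $\kappa_t(x,\cdot)$; the only parent of each $Y_{t,i}$ is $X_t$. That is, conditionally on all its non-descendants each variable has the law given by its kernel at its parent. The law of $Y_{t,i}$ given $X_t=x$ is a mixture $$P(Y_{t,i}\in C\mid X_t=x)=\sum_{y\in C}F_{t,i}(y\mid x)+\int_C f_{t,i}(y\mid x)\,dy ,$$ with point masses $F_{t,i}\ge0$ and a jointly measurable density $f_{t,i}\ge0$. Assume, for all $t\le T$ and all $i$: 1. there is a countable set $A_{t,i}\subset\mathbb R$ such that, almost surely, $F_{t,i}(y\mid X_t)=0$ for all $y\notin A_{t,i}$; 2. for Lebesgue-almost every $y$, $E[f_{t,i}(y\mid X_t)^p]<\infty$ for all $p\in\mathbb N$ (for instance, $f_{t,i}(y\mid\cdot)$ is bounded); 3. the test function $f_t:E_t\to\mathbb R$ is measurable and $E|f_t(X_t)|^p<\infty$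 for all $p\in\mathbb N$ (for instance, $f_t$ is bounded). **Algorithm.** The lexicographic particle filter with $K$ particles, run on data $y_0,\dots,y_T$, draws $x_0^{(1)},\dots,x_0^{(K)}$ independently from $\mu_0$. At each time $t$ it computes for each particle a pair $(d^{(k)},w^{(k)})$, starting from $(0,1)$ and updating, for $i=1,\dots,m_t$ in turn, by $$(d,w)\leftarrow\begin{cases}(d,\;w\,F_{t,i}(y_{t,i}\mid x_t^{(k)}))&\text{if }F_{t,i}(y_{t,i}\mid x_t^{(k)})>0,\\(d+1,\;w\,f_{t,i}(y_{t,i}\mid x_t^{(k)}))&\text{otherwise.}\end{cases}$$ It puts $d^\star=\min_{k:\,w^{(k)}\ne0}d^{(k)}$, sets $w^{(k)}\leftarrow0$ for all $k$ with $d^{(k)}>d^\star$, and outputs $$\hat f_t^{K}=\frac{\sum_k w^{(k)}f_t(x_t^{(k)})}{\sum_k w^{(k)}}.$$ If $t<T$, it then resamples: given the past, indices $a_t^{(1)},\dots,a_t^{(K)}$ are drawn independently with $P(a_t^{(k)}=j)=w^{(j)}/\sum_l w^{(l)}$ (arbitrarily if all weights vanish), and then $x_{t+1}^{(k)}$, $k=1,\dots,K$,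 are drawn independently from $\kappa_t(x_t^{(a_t^{(k)})},\cdot)$. **Theorem.** The lexicographic particle filter is consistent. For almost every realization $(y_t)_{t\le T}$ of the observations, if for every $K$ the filter with $K$ particles is run on $(y_t)_{t\le T}$, all runs being defined on one probability space with an arbitrary dependence between the runs for different $K$, then almost surely, for all $0\le t\le T$, $$\hat f_t^{K}\longrightarrow E[f_t(X_t)\mid Y_{0:t}=y_{0:t}]\qquad\text{as }K\to\infty .$$ -/

import Mathlib

open MeasureTheory ProbabilityTheory Filter Topology
open scoped NNReal ENNReal

noncomputable section

namespace LPF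

/-- A state-space model with mixed discrete/continuous observations. At time `t` the latent state
lives in the measurable space `E t`, and `m t` real variables `Y_{t,0}, …, Y_{t, m t - 1}` are
observed. The parent of `X_{t+1}` is `X_t` and the parent of every `Y_{t,i}` is `X_t`.
The law of `Y_{t,i}` given `X_t = x` is the mixture of a discrete distribution with point masses
`mass t i x y` and a part with Lebesgue density `dens t i x y`. -/
structure MixedSSM (E : ℕ → Type*) [∀ t, MeasurableSpace (E t)] (m : ℕ → ℕ) where
  /-- law of `X_0` -/
  init : Measure (E 0)
  /-- law of `X_{t+1}` given `X_t` -/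
  trans : ∀ t, Kernel (E t) (E (t + 1))
  /-- law of `Y_{t,i}` given `X_t` -/
  obs : ∀ t, Fin (m t) → Kernel (E t) ℝ
  /-- point masses `F_{t,i}(y | x)` -/
  mass : ∀ t, Fin (m t) → E t → ℝ → ℝ≥0
  /-- densities `f_{t,i}(y | x)` -/
  dens : ∀ t, Fin (m t) → E t → ℝ → ℝ≥0
  isProb_init : IsProbabilityMeasure init
  isMarkov_trans : ∀ t, IsMarkovKernel (trans t)
  isMarkov_obs : ∀ t i, IsMarkovKernel (obs t i)
  measurable_dens : ∀ t i, Measurable (fun p : E t × ℝ => dens t i p.1 p.2)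
  obs_eq : ∀ t i x, obs t i x =
    Measure.sum (fun y : ℝ => (mass t i x y : ℝ≥0∞) • Measure.dirac y) +
      volume.withDensity (fun y => (dens t i x y : ℝ≥0∞))

/-- One update of the tuple (number of densities, weight) at an observed value whose point mass
is `F` and whose density is `f`. -/
def lexUpdate (p : ℕ × ℝ≥0) (F f : ℝ≥0) : ℕ × ℝ≥0 :=
  if 0 < F then (p.1, p.2 * F) else (p.1 + 1, p.2 * f)

/-- The `σ`-algebra generated by `Y_0, …, Y_t`. -/
abbrev obsSigma {Ω : Type*} {m : ℕ → ℕ} (Y : ∀ t, Ω → Fin (m t) → ℝ) (t : ℕ) : MeasurableSpace Ω :=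
  ⨆ s, ⨆ (_ : s ≤ t), MeasurableSpace.comap (Y s) inferInstance

namespace MixedSSM

variable {E : ℕ → Type*} [∀ t, MeasurableSpace (E t)] {m : ℕ → ℕ}

/-- The random variables `X_0, …, X_T, Y_0, …, Y_T` on `(Ω, P)` have the joint law of the model:
`X_0` has the initial law, and the conditional law of every other variable given all its
non-descendants (parents included) is its kernel evaluated at its parent.
The non-descendants of `X_{t+1}` are `X_s, Y_s` with `s ≤ t`; those of `Y_{t,i}` are all variables
other than `Y_{t,i}` itself. -/
structure Represents (M : MixedSSM E m) (T : ℕ) {Ω : Type*} [MeasurableSpace Ω] (P : Measure Ω)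
    (X : ∀ t, Ω → E t) (Y : ∀ t, Ω → Fin (m t) → ℝ) : Prop where
  measurable_X : ∀ t ≤ T, Measurable (X t)
  measurable_Y : ∀ t ≤ T, Measurable (Y t)
  init : P.map (X 0) = M.init
  trans : ∀ t < T, ∀ B : Set (E (t + 1)), MeasurableSet B →
    P[(X (t + 1) ⁻¹' B).indicator (fun _ => (1 : ℝ)) |
        ⨆ s, ⨆ (_ : s ≤ t), MeasurableSpace.comap (X s) inferInstance ⊔
          MeasurableSpace.comap (Y s) inferInstance]
      =ᵐ[P] fun ω => (M.trans t (X t ω)).real B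
  obs : ∀ t ≤ T, ∀ i : Fin (m t), ∀ C : Set ℝ, MeasurableSet C →
    P[((fun ω => Y t ω i) ⁻¹' C).indicator (fun _ => (1 : ℝ)) |
        (⨆ s, ⨆ (_ : s ≤ T), MeasurableSpace.comap (X s) inferInstance) ⊔
          ⨆ q : Σ s, Fin (m s), ⨆ (_ : q.1 ≤ T ∧ q ≠ ⟨t, i⟩),
            MeasurableSpace.comap (fun ω => Y q.1 ω q.2) inferInstance]
      =ᵐ[P] fun ω => (M.obs t i (X t ω)).real C

/-- The tuple `(d, w)` of a particle in state `x` at time `t` when `y` is observed: start from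
`(0, 1)` and update at each observed coordinate in turn. -/
def lexWeight (M : MixedSSM E m) (t : ℕ) (y : Fin (m t) → ℝ) (x : E t) : ℕ × ℝ≥0 :=
  (List.finRange (m t)).foldl (fun p i => lexUpdate p (M.mass t i x (y i)) (M.dens t i x (y i)))
    (0, 1)

/-- The minimal number of densities among the particles of nonzero weight (an irrelevant `0` if
all weights vanish). -/
def dStar (M : MixedSSM E m) (t : ℕ) (y : Fin (m t) → ℝ) {K : ℕ} (x : Fin K → E t) : ℕ :=
  sInf {d | ∃ k, (M.lexWeight t y (x k)).2 ≠ 0 ∧ (M.lexWeight t y (x k)).1 = d}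

/-- The weight of the `k`-th particle after the weights of all particles with non-minimal `d`
have been set to zero. -/
def keptWeight (M : MixedSSM E m) (t : ℕ) (y : Fin (m t) → ℝ) {K : ℕ} (x : Fin K → E t)
    (k : Fin K) : ℝ :=
  if M.dStar t y x < (M.lexWeight t y (x k)).1 then 0 else ((M.lexWeight t y (x k)).2 : ℝ)

/-- The output of the lexicographic particle filter at time `t` for the test function `f`, when the
particles at time `t` are `x` and `y` is observed. -/
def output (M : MixedSSM E m) (t : ℕ) (y : Fin (m t) → ℝ) (f : E t → ℝ) {K : ℕ}
    (x : Fin K → E t) : ℝ :=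
  (∑ k, M.keptWeight t y x k * f (x k)) / ∑ k, M.keptWeight t y x k

/-- `(ξ, α)` is a run, on the probability space `(Ω', ν)`, of the lexicographic particle filter with
`K` particles on the data `y_0, …, y_T`. Here `ξ t ω' k` is the `k`-th particle at time `t` and
`α t ω' k` is the index of the particle at time `t` that is selected for the `k`-th place in the
resampling step at time `t`.
* The initial particles are independent with law `M.init`.
* Given the past, the resampling indices are independent, and index `j` has probability
  proportional to the kept weight of particle `j`; nothing is prescribed where all the kept
  weights are zero.
* Given the past and the resampled particles, the particles at time `t + 1` are independent, and
  the `k`-th one is drawn from the transition kernel at the `k`-th resampled particle. -/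
structure IsRun (M : MixedSSM E m) (T : ℕ) (y : ∀ t, Fin (m t) → ℝ) (K : ℕ)
    {Ω' : Type*} [MeasurableSpace Ω'] (ν : Measure Ω')
    (ξ : ∀ t, Ω' → Fin K → E t) (α : ℕ → Ω' → Fin K → Fin K) : Prop where
  measurable_particle : ∀ t ≤ T, Measurable (ξ t)
  measurable_index : ∀ t < T, Measurable (α t)
  init : ν.map (ξ 0) = Measure.pi (fun _ => M.init)
  resample : ∀ t < T, ∀ j : Fin K → Fin K, ∀ᵐ ω' ∂ν,
    (∑ k, M.keptWeight t (y t) (ξ t ω') k) ≠ 0 →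
    (ν[(α t ⁻¹' {j}).indicator (fun _ => (1 : ℝ)) |
        (⨆ s, ⨆ (_ : s ≤ t), MeasurableSpace.comap (ξ s) inferInstance) ⊔
          ⨆ s, ⨆ (_ : s < t), MeasurableSpace.comap (α s) inferInstance]) ω'
      = ∏ k, (M.keptWeight t (y t) (ξ t ω') (j k) / (∑ l, M.keptWeight t (y t) (ξ t ω') l))
  propagate : ∀ t < T, ∀ B : Set (Fin K → E (t + 1)), MeasurableSet B →
    ν[(ξ (t + 1) ⁻¹' B).indicator (fun _ => (1 : ℝ)) |
        ⨆ s, ⨆ (_ : s ≤ t), MeasurableSpace.comap (ξ s) inferInstance ⊔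
          MeasurableSpace.comap (α s) inferInstance]
      =ᵐ[ν] fun ω' => (Measure.pi (fun k => M.trans t (ξ t ω' (α t ω' k)))).real B

end MixedSSM

end LPF

end

/-! The lexicographic rule hides an ordinary likelihood. Let `A t i` be the countable set of
possible atoms of Y_{t,i}, and take as reference measure counting measure on `A t i` plus Lebesgue
measure (`atomRef`). Since `A t i` is Lebesgue-null, Y_{t,i} given X_t has a density with respect to
it: the point mass on `A t i`, the density off it. The product over i is the likelihood `lik`; the
model is dominated, and Bayes' formula (`bayes`) shows that the usual recursion `pred`, `filt`
yields the conditional laws, with nonzero normalizers for almost all data.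

At observed y, let n be the number of coordinates outside the atom sets. Almost every state has d ≥
n; if d = n the weight equals the likelihood, and if d > n some atom has mass zero, so the
likelihood vanishes (`lexWeight_of_mass_eq_zero`). Once one particle has positive likelihood, d* = n
and the kept weights are the likelihoods (`keptWeight_eq_lik`): the algorithm is a bootstrap
particle filter that does not need to know the atoms.

For that filter, resampling followed by propagation draws conditionally i.i.d. particles from a
weighted mixture of kernels (`sum_smul_piKernel`, `lintegral_step`). A fourth moment bound makes
error probabilities O(K⁻²), and Borel–Cantelli gives almost sure convergence from the law of each
run alone, whatever their joint dependence. Convergence of empirical means passes from t to t + 1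
for all test functions with all moments under the law of X_t (`tendsto_empirical_mean`). This class
is stable under products and kernel means, so the induction hypothesis also controls the random
conditional fourth moments, and likelihoods may be unbounded. -/

noncomputable section

namespace LPF

/-! ### Fourth moments of empirical means -/

section Moments

lemma integrable_pow_of_memLp {Ω : Type*} [MeasurableSpace Ω] {μ : Measure Ω}
    [IsProbabilityMeasure μ] {X : Ω → ℝ} {n a : ℕ} (hX : MemLp X n μ) (ha : a ≤ n) :
    Integrable (fun ω => X ω ^ a) μ := by
  have h1 : MemLp X a μ := hX.mono_exponent (by exact_mod_cast ha)
  have h2 := h1.integrable_norm_pow'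
  refine h2.mono (hX.1.pow a) (ae_of_all _ fun ω => by simp)

/-- Moment bounds for a sum of independent centered random variables. -/
lemma moments_sum_of_iIndepFun {Ω ι : Type*} [MeasurableSpace Ω] {μ : Measure Ω}
    [IsProbabilityMeasure μ] {Z : ι → Ω → ℝ} (hmeas : ∀ i, Measurable (Z i))
    (hZ : ∀ i, MemLp (Z i) (4 : ℕ) μ) (hind : iIndepFun Z μ) (h0 : ∀ i, ∫ ω, Z i ω ∂μ = 0)
    {c : ℝ} (hc : ∀ i, ∫ ω, Z i ω ^ 4 ∂μ ≤ c ^ 2) (hc0 : 0 ≤ c) (s : Finset ι) :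
    ∫ ω, (∑ i ∈ s, Z i ω) ∂μ = 0 ∧ ∫ ω, (∑ i ∈ s, Z i ω) ^ 2 ∂μ ≤ s.card * c ∧
      ∫ ω, (∑ i ∈ s, Z i ω) ^ 4 ∂μ ≤ 3 * s.card ^ 2 * c ^ 2 := by
  classical
  have hsq : ∀ i, ∫ ω, Z i ω ^ 2 ∂μ ≤ c := by
    intro i
    have hv : 0 ≤ ∫ ω, Z i ω ^ 2 ∂μ := integral_nonneg fun ω => by positivity
    have i4 := integrable_pow_of_memLp (hZ i) (le_refl 4)
    have i2 := integrable_pow_of_memLp (hZ i) (show 2 ≤ 4 by norm_num)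
    set v := ∫ ω, Z i ω ^ 2 ∂μ with hvdef
    -- The variance of Z² is nonnegative, so v² ≤ E Z⁴ ≤ c². Writing the fourth moment bound as a
    -- square makes `c` itself the bound on the second moment.
    have h : 0 ≤ ∫ ω, (Z i ω ^ 2 - v) ^ 2 ∂μ := integral_nonneg fun ω => by positivity
    have h' : ∫ ω, (Z i ω ^ 2 - v) ^ 2 ∂μ = ∫ ω, Z i ω ^ 4 ∂μ - 2 * v * v + v ^ 2 := by
      have : ∀ ω, (Z i ω ^ 2 - v) ^ 2 = Z i ω ^ 4 - 2 * v * Z i ω ^ 2 + v ^ 2 := fun ω => by ring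
      simp_rw [this]
      have i42 : Integrable (fun ω => Z i ω ^ 4 - 2 * v * Z i ω ^ 2) μ := i4.sub (i2.const_mul _)
      rw [integral_add i42 (integrable_const _), integral_sub i4 (i2.const_mul _), integral_const_mul, ← hvdef]
      simp
    exact abs_le_of_sq_le_sq' (by nlinarith [hc i]) hc0 |>.2
  induction s using Finset.induction_on with
  | empty => simp
  | insert a s ha ih =>
    obtain ⟨ih1, ih2, ih4⟩ := ih
    set S : Ω → ℝ := fun ω => ∑ i ∈ s, Z i ω with hS
    have hSmem : MemLp S (4 : ℕ) μ := memLp_finsetSum s fun i _ => hZ i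
    have hSind : IndepFun S (Z a) μ := by
      have := hind.indepFun_finsetSum_of_notMem hmeas ha
      convert this using 1
      ext ω; simp [hS]
    have hp : ∀ j k : ℕ, j ≤ 4 → k ≤ 4 →
        Integrable (fun ω => S ω ^ j * Z a ω ^ k) μ ∧
        ∫ ω, S ω ^ j * Z a ω ^ k ∂μ = (∫ ω, S ω ^ j ∂μ) * ∫ ω, Z a ω ^ k ∂μ := by
      intro j k hj hk
      have hi : IndepFun (fun ω => S ω ^ j) (fun ω => Z a ω ^ k) μ :=
        hSind.comp (φ := fun x => x ^ j) (ψ := fun x => x ^ k) (by fun_prop) (by fun_prop)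
      have i1 := integrable_pow_of_memLp hSmem hj
      have i2 := integrable_pow_of_memLp (hZ a) hk
      exact ⟨hi.integrable_mul i1 i2, hi.integral_fun_mul_eq_mul_integral i1.1 i2.1⟩
    have e : ∀ ω, ∑ i ∈ insert a s, Z i ω = S ω + Z a ω := fun ω => by
      rw [Finset.sum_insert ha, add_comm]
    simp_rw [e]
    have hS1 : Integrable S μ := by simpa using integrable_pow_of_memLp hSmem (a := 1) (by norm_num)
    have hZ1 : Integrable (Z a) μ := by
      simpa using integrable_pow_of_memLp (hZ a) (a := 1) (by norm_num)
    have hS2 := integrable_pow_of_memLp hSmem (a := 2) (by norm_num)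
    have hZ2 := integrable_pow_of_memLp (hZ a) (a := 2) (by norm_num)
    have hS4 := integrable_pow_of_memLp hSmem (a := 4) (by norm_num)
    have hZ4 := integrable_pow_of_memLp (hZ a) (a := 4) (by norm_num)
    have hcard : ((insert a s).card : ℝ) = s.card + 1 := by
      rw [Finset.card_insert_of_notMem ha]; push_cast; rfl
    rw [hcard]
    have p11 := hp 1 1 (by norm_num) (by norm_num)
    have p31 := hp 3 1 (by norm_num) (by norm_num)
    have p22 := hp 2 2 (by norm_num) (by norm_num)
    have p13 := hp 1 3 (by norm_num) (by norm_num)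
    -- Every mixed term with an unpaired centered factor vanishes; in the fourth power only S⁴,
    -- 6S²Z² and Z⁴ survive.
    simp only [pow_one, h0, mul_zero] at p11 p31 p13
    rw [ih1, zero_mul] at p13
    refine ⟨?_, ?_, ?_⟩
    · rw [integral_add hS1 hZ1, ih1, h0, add_zero]
    · have : ∀ ω, (S ω + Z a ω) ^ 2 = S ω ^ 2 + 2 * (S ω * Z a ω) + Z a ω ^ 2 := fun ω => by ring
      simp_rw [this]
      have j1 : Integrable (fun ω => S ω ^ 2 + 2 * (S ω * Z a ω)) μ := hS2.add (p11.1.const_mul _)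
      rw [integral_add j1 hZ2, integral_add hS2 (p11.1.const_mul _),
        integral_const_mul, p11.2]
      linarith [hsq a]
    · have : ∀ ω, (S ω + Z a ω) ^ 4 = S ω ^ 4 + 4 * (S ω ^ 3 * Z a ω) +
          6 * (S ω ^ 2 * Z a ω ^ 2) + 4 * (S ω * Z a ω ^ 3) + Z a ω ^ 4 := fun ω => by ring
      simp_rw [this]
      have j1 := hS4.add (p31.1.const_mul 4)
      have j2 := j1.add (p22.1.const_mul 6)
      have j3 := j2.add (p13.1.const_mul 4)
      simp only [Pi.add_def] at j1 j2 j3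
      rw [integral_add j3 hZ4, integral_add j2 (p13.1.const_mul _),
        integral_add j1 (p22.1.const_mul _), integral_add hS4 (p31.1.const_mul _),
        integral_const_mul, integral_const_mul, integral_const_mul, p31.2, p22.2, p13.2]
      have hv : 0 ≤ ∫ ω, Z a ω ^ 2 ∂μ := integral_nonneg fun ω => by positivity
      have hprod : (∫ ω, S ω ^ 2 ∂μ) * ∫ ω, Z a ω ^ 2 ∂μ ≤ (s.card * c) * c :=
        mul_le_mul ih2 (hsq a) hv (by positivity)
      have := hc a
      -- With n summands: 3n² + 6n + 1 ≤ 3(n + 1)².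
      nlinarith [sq_nonneg c]

/-- Fourth moment bound for the error of an empirical mean. -/
lemma lintegral_empirical_error_le {E : Type*} [MeasurableSpace E] {μ : Measure E}
    [IsProbabilityMeasure μ] {φ : E → ℝ} (hφ : Measurable φ) {R : ℝ≥0}
    (hR : ∫⁻ x, ‖φ x‖ₑ ^ 4 ∂μ ≤ R) {K : ℕ} (hK : 0 < K) :
    ∫⁻ z : Fin K → E, ‖(∑ k, φ (z k)) / K - ∫ x, φ x ∂μ‖ₑ ^ 4 ∂(Measure.pi fun _ => μ)
      ≤ ENNReal.ofReal (48 * R / K ^ 2) := by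
  have hmem : MemLp φ (4 : ℕ) μ := by
    refine ⟨hφ.aestronglyMeasurable, ?_⟩
    rw [eLpNorm_lt_top_iff_lintegral_rpow_enorm_lt_top (by norm_num) (by simp)]
    refine lt_of_le_of_lt ?_ (ENNReal.coe_lt_top (r := R))
    refine le_trans (le_of_eq (lintegral_congr fun x => ?_)) hR
    rw [ENNReal.toReal_natCast, ENNReal.rpow_natCast]
  set m := ∫ x, φ x ∂μ with hm
  have hint : Integrable φ μ := by simpa using integrable_pow_of_memLp hmem (a := 1) (by norm_num)
  have hint4 : Integrable (fun x => φ x ^ 4) μ := integrable_pow_of_memLp hmem le_rfl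
  have hR4 : ∫ x, φ x ^ 4 ∂μ ≤ R := by
    rw [integral_eq_lintegral_of_nonneg_ae (ae_of_all _ fun x => by positivity) hint4.1]
    refine ENNReal.toReal_le_of_le_ofReal R.2 ?_
    simp only [ENNReal.ofReal_coe_nnreal]
    refine le_trans (le_of_eq ?_) hR
    refine lintegral_congr fun x => ?_
    rw [← enorm_pow, Real.enorm_eq_ofReal (by positivity)]
  set Z : Fin K → (Fin K → E) → ℝ := fun k z => φ (z k) - m with hZ
  have hmemZ0 : MemLp (fun x => φ x - m) (4 : ℕ) μ := hmem.sub (memLp_const _)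
  have hmp : ∀ k : Fin K, MeasurePreserving (Function.eval k) (Measure.pi fun _ : Fin K => μ) μ :=
    fun k => measurePreserving_eval (fun _ => μ) k
  have hZmem : ∀ k, MemLp (Z k) (4 : ℕ) (Measure.pi fun _ : Fin K => μ) := fun k =>
    hmemZ0.comp_measurePreserving (hmp k)
  have hind : iIndepFun Z (Measure.pi fun _ : Fin K => μ) :=
    iIndepFun_pi (X := fun (_ : Fin K) (x : E) => φ x - m)
      fun _ => (hφ.sub_const m).aemeasurable
  have hm4 : m ^ 4 ≤ R := by
    refine le_trans ?_ hR4
    exact ConvexOn.map_integral_le (g := fun x : ℝ => x ^ 4) (f := φ)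
      (Even.convexOn_pow (by decide)) (by fun_prop) isClosed_univ (by simp) hint hint4
  -- (a - b)⁴ ≤ 8(a⁴ + b⁴) and m⁴ ≤ R give 16R = (4√R)²; the final constant is 48 = 3 · 16.
  have hc : ∀ k, ∫ z, Z k z ^ 4 ∂(Measure.pi fun _ : Fin K => μ) ≤ (4 * √(R : ℝ)) ^ 2 := by
    intro k
    have e1 : ∫ z, Z k z ^ 4 ∂(Measure.pi fun _ : Fin K => μ) = ∫ x, (φ x - m) ^ 4 ∂μ :=
      integral_comp_eval (μ := fun _ : Fin K => μ) (i := k) (f := fun x => (φ x - m) ^ 4)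
        (by fun_prop)
    rw [e1, mul_pow, Real.sq_sqrt R.coe_nonneg]
    calc ∫ x, (φ x - m) ^ 4 ∂μ ≤ ∫ x, 8 * φ x ^ 4 + 8 * m ^ 4 ∂μ := by
          refine integral_mono (integrable_pow_of_memLp hmemZ0 le_rfl)
            ((hint4.const_mul 8).add (integrable_const _)) fun x => ?_
          simp only
          nlinarith [sq_nonneg (φ x + m), sq_nonneg (φ x - m), sq_nonneg (φ x ^ 2 - m ^ 2),
            sq_nonneg (φ x ^ 2 - m ^ 2), sq_nonneg ((φ x + m) ^ 2)]
      _ = 8 * ∫ x, φ x ^ 4 ∂μ + 8 * m ^ 4 := by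
          rw [integral_add (hint4.const_mul 8) (integrable_const _), integral_const_mul]; simp
      _ ≤ 4 ^ 2 * R := by linarith
  have hmean : ∀ k, ∫ z, Z k z ∂(Measure.pi fun _ : Fin K => μ) = 0 := by
    intro k
    have e1 : ∫ z, Z k z ∂(Measure.pi fun _ : Fin K => μ) = ∫ x, (φ x - m) ∂μ :=
      integral_comp_eval (μ := fun _ : Fin K => μ) (i := k) (f := fun x => (φ x - m))
        (by fun_prop)
    rw [e1, integral_sub hint (integrable_const _)]
    simp [hm]
  have key := (moments_sum_of_iIndepFun (fun k => by fun_prop) hZmem hind hmean hc (by positivity)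
    Finset.univ).2.2
  have hKr : (0 : ℝ) < K := by exact_mod_cast hK
  have e2 : ∀ z : Fin K → E, (∑ k, φ (z k)) / K - m = (∑ k, Z k z) / K := by
    intro z
    simp only [hZ, Finset.sum_sub_distrib, Finset.sum_const, Finset.card_univ, Fintype.card_fin,
      nsmul_eq_mul]
    field_simp
  have hSmem : MemLp (fun z => ∑ k, Z k z) (4 : ℕ) (Measure.pi fun _ : Fin K => μ) :=
    memLp_finsetSum _ fun i _ => hZmem i
  have hSint := integrable_pow_of_memLp hSmem le_rfl
  have e3 : ∀ z : Fin K → E, ‖(∑ k, φ (z k)) / K - m‖ₑ ^ 4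
      = ENNReal.ofReal ((∑ k, Z k z) ^ 4 / K ^ 4) := by
    intro z
    rw [e2, ← enorm_pow, Real.enorm_eq_ofReal (by positivity), div_pow]
  simp_rw [e3]
  rw [← ofReal_integral_eq_lintegral_ofReal (hSint.div_const _)
    (ae_of_all _ fun z => by positivity), integral_div]
  refine ENNReal.ofReal_le_ofReal ?_
  rw [div_le_div_iff₀ (by positivity) (by positivity)]
  rw [Finset.card_univ, Fintype.card_fin, mul_pow, Real.sq_sqrt R.coe_nonneg] at key
  calc _ ≤ (3 * (K : ℝ) ^ 2 * (4 ^ 2 * R)) * K ^ 2 := by gcongr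
    _ = _ := by ring

end Moments

/-! ### Products of measures with densities -/

section Pi

lemma lintegral_pi_prod : ∀ {n : ℕ} {α : Fin n → Type*} [∀ i, MeasurableSpace (α i)]
    (μ : ∀ i, Measure (α i)) [∀ i, SigmaFinite (μ i)] (f : ∀ i, α i → ℝ≥0∞),
    (∀ i, Measurable (f i)) →
    ∫⁻ y, ∏ i, f i (y i) ∂(Measure.pi μ) = ∏ i, ∫⁻ y, f i y ∂(μ i)
  | 0, α, _, μ, _, f, _ => by simp
  | n + 1, α, _, μ, _, f, hf => by
    have := (measurePreserving_piFinSuccAbove μ 0).symm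
    rw [← this.lintegral_comp_emb (MeasurableEquiv.measurableEmbedding _)]
    simp only [Fin.prod_univ_succ]
    have e : ∀ z : α 0 × (∀ j : Fin n, α (Fin.succAbove 0 j)),
        f 0 ((MeasurableEquiv.piFinSuccAbove α 0).symm z 0) *
          ∏ i : Fin n, f i.succ ((MeasurableEquiv.piFinSuccAbove α 0).symm z i.succ)
        = f 0 z.1 * ∏ i : Fin n, f (Fin.succAbove 0 i) (z.2 i) := by
      intro z
      rfl
    simp_rw [e]
    have ih := lintegral_pi_prod (fun j : Fin n => μ (Fin.succAbove 0 j))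
      (fun j => f (Fin.succAbove 0 j)) (fun j => hf _)
    have hm : Measurable fun z : ∀ j : Fin n, α (Fin.succAbove 0 j) =>
        ∏ i, f (Fin.succAbove 0 i) (z i) :=
      Finset.measurable_fun_prod _ fun i _ => (hf _).comp (measurable_pi_apply i)
    rw [lintegral_prod_mul (hf 0).aemeasurable hm.aemeasurable, ih]
    rfl

/-- On a box the indicator times the product density is again a product of functions of one
coordinate, so Tonelli applies. -/
lemma pi_withDensity {n : ℕ} {α : Fin n → Type*} [∀ i, MeasurableSpace (α i)]
    (μ : ∀ i, Measure (α i)) [∀ i, SigmaFinite (μ i)] (f : ∀ i, α i → ℝ≥0∞)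
    (hf : ∀ i, Measurable (f i)) [∀ i, SigmaFinite ((μ i).withDensity (f i))] :
    Measure.pi (fun i => (μ i).withDensity (f i))
      = (Measure.pi μ).withDensity (fun y => ∏ i, f i (y i)) := by
  refine Measure.pi_eq fun s hs => ?_
  rw [withDensity_apply _ (MeasurableSet.univ_pi hs), ← lintegral_indicator (MeasurableSet.univ_pi hs)]
  have : ∀ y : ∀ i, α i, (Set.univ.pi s).indicator (fun y => ∏ i, f i (y i)) y
      = ∏ i, (s i).indicator (f i) (y i) := by
    intro y
    by_cases hy : y ∈ Set.univ.pi s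
    · rw [Set.indicator_of_mem hy]
      exact Finset.prod_congr rfl fun i _ => by rw [Set.indicator_of_mem (hy i trivial)]
    · rw [Set.indicator_of_notMem hy]
      simp only [Set.mem_pi, Set.mem_univ, true_implies, not_forall] at hy
      obtain ⟨i, hi⟩ := hy
      exact (Finset.prod_eq_zero (Finset.mem_univ i) (Set.indicator_of_notMem hi _)).symm
  simp_rw [this]
  rw [lintegral_pi_prod μ _ fun i => (hf i).indicator (hs i)]
  exact Finset.prod_congr rfl fun i _ => by
    rw [lintegral_indicator (hs i), withDensity_apply _ (hs i)]

end Pi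

/-! ### Integrating against a conditional probability -/

section CondExp

/-- Translates the conditional laws that define the model and the runs into identities of lower
integrals, free of integrability conditions. For an indicator `U` it is the defining property of
conditional expectation; sums and monotone limits follow. -/
lemma lintegral_mul_indicator_eq_condExp {Ω : Type*} {m m₀ : MeasurableSpace Ω} {P : Measure Ω}
    [IsProbabilityMeasure P] (hm : m ≤ m₀) {V : Set Ω} (hV : MeasurableSet[m₀] V)
    {U : Ω → ℝ≥0∞} (hU : Measurable[m] U) :
    ∫⁻ ω, U ω * V.indicator 1 ω ∂P
      = ∫⁻ ω, U ω * ENNReal.ofReal ((P[V.indicator (fun _ => (1 : ℝ)) | m]) ω) ∂P := by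
  set c := P[V.indicator (fun _ => (1 : ℝ)) | m] with hc
  have hcm : Measurable[m] c := stronglyMeasurable_condExp.measurable
  have hVint : Integrable (V.indicator (fun _ => (1 : ℝ))) P := (integrable_const _).indicator hV
  have hc0 : 0 ≤ᵐ[P] c := condExp_nonneg (ae_of_all _ fun ω => Set.indicator_nonneg (by simp) ω)
  have hV1 : Measurable[m₀] (V.indicator (1 : Ω → ℝ≥0∞)) := measurable_one.indicator hV
  have hcm' : Measurable[m₀] fun ω => ENNReal.ofReal (c ω) := (hcm.mono hm le_rfl).ennreal_ofReal
  refine Measurable.ennreal_induction (mα := m)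
    (motive := fun U => ∫⁻ ω, U ω * V.indicator 1 ω ∂P = ∫⁻ ω, U ω * ENNReal.ofReal (c ω) ∂P)
    ?_ ?_ ?_ hU
  · intro a s hs
    have e : ∀ (g : Ω → ℝ≥0∞), (fun ω => s.indicator (fun _ => a) ω * g ω)
        = fun ω => a * s.indicator g ω := by
      intro g
      ext ω
      by_cases h : ω ∈ s <;> simp [h]
    rw [e, e (fun ω => ENNReal.ofReal (c ω))]
    rw [lintegral_const_mul _ (hV1.indicator (hm s hs)),
      lintegral_const_mul _ (hcm'.indicator (hm s hs)),
      lintegral_indicator (hm s hs), lintegral_indicator (hm s hs)]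
    congr 1
    rw [← ofReal_integral_eq_lintegral_ofReal integrable_condExp.integrableOn
      (ae_restrict_of_ae hc0), setIntegral_condExp hm hVint hs,
      integral_indicator hV, lintegral_indicator hV]
    simp
  · intro f g _ hf hg ihf ihg
    simp only [Pi.add_apply, add_mul]
    have h1 : Measurable[m₀] fun ω => f ω * V.indicator 1 ω := (hf.mono hm le_rfl).mul hV1
    have h2 : Measurable[m₀] fun ω => f ω * ENNReal.ofReal (c ω) := (hf.mono hm le_rfl).mul hcm'
    rw [lintegral_add_left h1, lintegral_add_left h2, ihf, ihg]
  · intro f hf hmono ih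
    simp only [ENNReal.iSup_mul]
    have h1 : ∀ n, Measurable[m₀] fun ω => f n ω * V.indicator 1 ω :=
      fun n => ((hf n).mono hm le_rfl).mul hV1
    have h2 : ∀ n, Measurable[m₀] fun ω => f n ω * ENNReal.ofReal (c ω) :=
      fun n => ((hf n).mono hm le_rfl).mul hcm'
    rw [lintegral_iSup h1 fun i j hij ω => mul_le_mul_left (hmono hij ω) _,
      lintegral_iSup h2 fun i j hij ω => mul_le_mul_left (hmono hij ω) _]
    simp_rw [ih]

end CondExp

/-! ### Reweighting by a likelihood -/

section Posterior

variable {E : Type*} [MeasurableSpace E]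

/-- The normalized reweighting of `μ` by the likelihood `g` (a junk value if the normalizing
constant is `0` or `∞`). -/
def posterior (μ : Measure E) (g : E → ℝ≥0) : Measure E :=
  μ.withDensity fun x => (g x : ℝ≥0∞) / ∫⁻ x', g x' ∂μ

lemma posterior_absolutelyContinuous (μ : Measure E) (g : E → ℝ≥0) : posterior μ g ≪ μ :=
  withDensity_absolutelyContinuous _ _

lemma posterior_apply {μ : Measure E} {g : E → ℝ≥0} (hg : Measurable g) {B : Set E}
    (hB : MeasurableSet B) :
    posterior μ g B = (∫⁻ x in B, g x ∂μ) / ∫⁻ x, g x ∂μ := by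
  rw [posterior, withDensity_apply _ hB]
  simp_rw [div_eq_mul_inv]
  rw [lintegral_mul_const _ hg.coe_nnreal_ennreal]

lemma lintegral_posterior {μ : Measure E} {g : E → ℝ≥0} (hg : Measurable g) {φ : E → ℝ≥0∞}
    (hφ : Measurable φ) :
    ∫⁻ x, φ x ∂(posterior μ g) = (∫⁻ x, g x * φ x ∂μ) / ∫⁻ x, g x ∂μ := by
  rw [posterior, lintegral_withDensity_eq_lintegral_mul _ (by fun_prop) hφ]
  simp_rw [div_eq_mul_inv]
  rw [← lintegral_mul_const _ (by fun_prop)]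
  refine lintegral_congr fun x => ?_
  simp only [Pi.mul_apply]
  ring

/-- The conventions 0/0 = 0 and ∞/∞ = 0 make the degenerate cases harmless, so posteriors form
finite kernels without restriction on the data. -/
lemma posterior_univ_le (μ : Measure E) {g : E → ℝ≥0} (hg : Measurable g) :
    posterior μ g Set.univ ≤ 1 := by
  rw [posterior_apply hg MeasurableSet.univ, setLIntegral_univ]
  exact ENNReal.div_self_le_one

/-- Excluding a zero normalizer keeps the density finite. An infinite one is allowed: the posterior
is then zero, and the real denominator takes the default value 0. -/
lemma integral_posterior {μ : Measure E} {g : E → ℝ≥0} (hg : Measurable g)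
    (h0 : ∫⁻ x, g x ∂μ ≠ 0) (φ : E → ℝ) :
    ∫ x, φ x ∂(posterior μ g) = (∫ x, g x * φ x ∂μ) / ∫ x, (g x : ℝ) ∂μ := by
  rw [posterior, integral_withDensity_eq_integral_toReal_smul (by fun_prop)
    (ae_of_all _ fun x => ENNReal.div_lt_top ENNReal.coe_ne_top h0)]
  have hZ : ∫ x, (g x : ℝ) ∂μ = (∫⁻ x, g x ∂μ).toReal := by
    rw [integral_eq_lintegral_of_nonneg_ae (ae_of_all _ fun x => (g x).coe_nonneg) (by fun_prop)]
    simp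
  rw [hZ, ← integral_div]
  refine integral_congr_ae (ae_of_all _ fun x => ?_)
  simp only [ENNReal.toReal_div, ENNReal.coe_toReal, smul_eq_mul]
  ring

lemma measurable_posterior {S : Type*} [MeasurableSpace S] (κ : Kernel S E) [IsFiniteKernel κ]
    {g : S → E → ℝ≥0} (hg : Measurable (Function.uncurry g)) :
    Measurable fun s => posterior (κ s) (g s) := by
  have hZ : Measurable fun s => ∫⁻ x, (g s x : ℝ≥0∞) ∂(κ s) :=
    Measurable.lintegral_kernel_prod_right (f := fun s x => (g s x : ℝ≥0∞)) hg.coe_nnreal_ennreal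
  have hf : Measurable (Function.uncurry fun s x => (g s x : ℝ≥0∞) / ∫⁻ x', g s x' ∂(κ s)) :=
    hg.coe_nnreal_ennreal.div (hZ.comp measurable_fst)
  have := (Kernel.withDensity κ fun s x => (g s x : ℝ≥0∞) / ∫⁻ x', g s x' ∂(κ s)).measurable
  convert this using 2 with s
  rw [Kernel.withDensity_apply _ hf]
  rfl

end Posterior

/-! ### Bayes' formula -/

section Bayes

/-- Bayes' formula for a conditional prior `η` of `X` given `H` and an observation `V` whose
conditional law given `(H, X)` has density `g · X` with respect to `ρ`. -/
lemma bayes {Ω S 𝒴 E : Type*} [MeasurableSpace Ω] [MeasurableSpace S] [MeasurableSpace 𝒴]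
    [MeasurableSpace E] {P : Measure Ω} [IsProbabilityMeasure P] {H : Ω → S} {V : Ω → 𝒴}
    {X : Ω → E} (hH : Measurable H) (hV : Measurable V) (hX : Measurable X) (ρ : Measure 𝒴)
    [SigmaFinite ρ] (η : Kernel S E) [IsFiniteKernel η] {g : 𝒴 → E → ℝ≥0}
    (hg : Measurable (Function.uncurry g))
    (hHX : P.map (fun ω => (H ω, X ω)) = (P.map H) ⊗ₘ η)
    (hVlaw : ∀ A B C, MeasurableSet A → MeasurableSet B → MeasurableSet C →
      P (H ⁻¹' A ∩ X ⁻¹' B ∩ V ⁻¹' C)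
        = ∫⁻ ω in H ⁻¹' A ∩ X ⁻¹' B, ∫⁻ y in C, g y (X ω) ∂ρ ∂P) :
    (∀ᵐ ω ∂P, ∫⁻ x, g (V ω) x ∂(η (H ω)) ≠ 0 ∧ ∫⁻ x, g (V ω) x ∂(η (H ω)) ≠ ∞) ∧
    ∀ (D : Set (S × 𝒴)) (B : Set E), MeasurableSet D → MeasurableSet B →
      P ((fun ω => (H ω, V ω)) ⁻¹' D ∩ X ⁻¹' B)
        = ∫⁻ ω in (fun ω => (H ω, V ω)) ⁻¹' D, posterior (η (H ω)) (g (V ω)) B ∂P := by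
  have hHV : Measurable fun ω => (H ω, V ω) := hH.prodMk hV
  have hHXm : Measurable fun ω => (H ω, X ω) := hH.prodMk hX
  have : IsProbabilityMeasure (P.map H) := Measure.isProbabilityMeasure_map hH.aemeasurable
  set ν := (P.map H).prod ρ with hν
  have hgE : Measurable fun p : 𝒴 × E => (g p.1 p.2 : ℝ≥0∞) := hg.coe_nnreal_ennreal
  have hq : ∀ B, MeasurableSet B →
      Measurable fun p : S × 𝒴 => ∫⁻ x in B, g p.2 x ∂(η p.1) := by
    intro B hB
    have := Measurable.lintegral_kernel_prod_right (κ := Kernel.comap η (Prod.fst : S × 𝒴 → S)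
      measurable_fst) (f := fun p x => B.indicator (fun x => (g p.2 x : ℝ≥0∞)) x) (by
        have : Function.uncurry (fun (p : S × 𝒴) x => B.indicator (fun x => (g p.2 x : ℝ≥0∞)) x)
            = (Prod.snd ⁻¹' B).indicator (fun r : (S × 𝒴) × E => (g r.1.2 r.2 : ℝ≥0∞)) := by
          ext ⟨p, x⟩
          by_cases h : x ∈ B <;> simp [Function.uncurry, h]
        rw [this]
        exact (hgE.comp (measurable_fst.snd.prodMk measurable_snd)).indicator (measurable_snd hB))
    simpa [Kernel.comap_apply, lintegral_indicator hB] using this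
  -- The whole proof rests on these densities: B = E gives the law of (H, V) with density Z, and the
  -- posterior mass of B is the quotient of the two densities.
  have hlaw : ∀ B, MeasurableSet B → (P.restrict (X ⁻¹' B)).map (fun ω => (H ω, V ω))
      = ν.withDensity fun p => ∫⁻ x in B, g p.2 x ∂(η p.1) := by
    intro B hB
    refine Measure.ext_prod fun {A C} hA hC => ?_
    rw [Measure.map_apply hHV (hA.prod hC), Measure.restrict_apply (hHV (hA.prod hC)),
      withDensity_apply _ (hA.prod hC)]
    have e1 : (fun ω => (H ω, V ω)) ⁻¹' A ×ˢ C ∩ X ⁻¹' B = H ⁻¹' A ∩ X ⁻¹' B ∩ V ⁻¹' C := by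
      ext ω
      simp only [Set.mem_inter_iff, Set.mem_preimage, Set.mem_prod]
      tauto
    have hGm : Measurable fun x => ∫⁻ y in C, g y x ∂ρ :=
      Measurable.lintegral_prod_left' (f := fun p : 𝒴 × E => (g p.1 p.2 : ℝ≥0∞)) hgE
    have hGm2 : Measurable fun p : S × E => ∫⁻ y in C, g y p.2 ∂ρ := hGm.comp measurable_snd
    rw [e1, hVlaw A B C hA hB hC]
    have e2 : H ⁻¹' A ∩ X ⁻¹' B = (fun ω => (H ω, X ω)) ⁻¹' (A ×ˢ B) := by
      ext ω; simp
    rw [e2, ← setLIntegral_map (f := fun p : S × E => ∫⁻ y in C, g y p.2 ∂ρ) (hA.prod hB)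
      hGm2 hHXm, hHX, ← lintegral_indicator (hA.prod hB),
      Measure.lintegral_compProd (hGm2.indicator (hA.prod hB)), hν,
      ← Measure.prod_restrict, lintegral_prod _ (hq B hB).aemeasurable,
      ← lintegral_indicator hA]
    refine lintegral_congr fun h => ?_
    by_cases hh : h ∈ A
    · rw [Set.indicator_of_mem hh]
      have : ∀ x, (A ×ˢ B).indicator (fun p : S × E => ∫⁻ y in C, g y p.2 ∂ρ) (h, x)
          = B.indicator (fun x => ∫⁻ y in C, g y x ∂ρ) x := by
        intro x
        by_cases hx : x ∈ B <;> simp [hh, hx]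
      simp_rw [this]
      rw [lintegral_indicator hB]
      exact lintegral_lintegral_swap (hgE.comp measurable_swap).aemeasurable
    · simp [hh]
  set Z : S × 𝒴 → ℝ≥0∞ := fun p => ∫⁻ x, g p.2 x ∂(η p.1) with hZ
  have hZm : Measurable Z := by simpa using hq _ MeasurableSet.univ
  have hHVlaw : P.map (fun ω => (H ω, V ω)) = ν.withDensity Z := by
    simpa using hlaw _ MeasurableSet.univ
  have hfin : ∀ᵐ p ∂ν, Z p ≠ ∞ := by
    refine (ae_lt_top hZm ?_).mono fun p hp => hp.ne
    rw [← setLIntegral_univ, ← withDensity_apply _ MeasurableSet.univ, ← hHVlaw,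
      Measure.map_apply hHV MeasurableSet.univ]
    simp
  -- A random variable almost surely avoids the zeros of its own density; Z is finite a.e. because
  -- it has total integral one.
  have hgood : ∀ᵐ p ∂(ν.withDensity Z), Z p ≠ 0 ∧ Z p ≠ ∞ := by
    filter_upwards [(ae_withDensity_iff hZm).2 (ae_of_all _ fun p hp => hp),
      withDensity_absolutelyContinuous ν Z hfin] with p h1 h2 using ⟨h1, h2⟩
  rw [← hHVlaw] at hgood
  refine ⟨ae_of_ae_map hHV.aemeasurable hgood, fun D B hD hB => ?_⟩
  have hpost : ∀ p : S × 𝒴, posterior (η p.1) (g p.2) B = (∫⁻ x in B, g p.2 x ∂(η p.1)) / Z p :=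
    fun p => posterior_apply (hg.comp measurable_prodMk_left) hB
  have hpm : Measurable fun p : S × 𝒴 => posterior (η p.1) (g p.2) B := by
    simp_rw [hpost]
    exact (hq B hB).div hZm
  rw [← setLIntegral_map (f := fun p : S × 𝒴 => posterior (η p.1) (g p.2) B) hD hpm hHV, hHVlaw,
    setLIntegral_withDensity_eq_setLIntegral_mul _ hZm hpm hD]
  have e3 : P ((fun ω => (H ω, V ω)) ⁻¹' D ∩ X ⁻¹' B)
      = (P.restrict (X ⁻¹' B)).map (fun ω => (H ω, V ω)) D := by
    rw [Measure.map_apply hHV hD, Measure.restrict_apply (hHV hD)]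
  rw [e3, hlaw B hB, withDensity_apply _ hD]
  refine lintegral_congr_ae (ae_restrict_of_ae ?_)
  filter_upwards [hfin] with p hp
  rw [Pi.mul_apply, hpost]
  -- Where Z vanishes, so does the numerator, which is at most Z.
  by_cases h0 : Z p = 0
  · rw [h0, zero_mul]
    exact le_antisymm (h0 ▸ setLIntegral_le_lintegral _ _) bot_le
  · exact (ENNReal.mul_div_cancel h0 hp).symm

end Bayes

/-! ### The recursion of predictive laws -/

section PredictiveLaw

variable {E : ℕ → Type*} [∀ t, MeasurableSpace (E t)]

/-- The predictive laws of the filter with likelihoods `g`. -/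
def predLaw (μ : Measure (E 0)) (κ : ∀ t, Kernel (E t) (E (t + 1))) (g : ∀ t, E t → ℝ≥0) :
    ∀ t, Measure (E t)
  | 0 => μ
  | t + 1 => (posterior (predLaw μ κ g t) (g t)).bind (κ t)

lemma predLaw_congr (μ : Measure (E 0)) (κ : ∀ t, Kernel (E t) (E (t + 1)))
    {g g' : ∀ t, E t → ℝ≥0} (t : ℕ) (h : ∀ s < t, g s = g' s) :
    predLaw μ κ g t = predLaw μ κ g' t := by
  induction t with
  | zero => rfl
  | succ t ih => simp only [predLaw]; rw [ih fun s hs => h s (by omega), h t (by omega)]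

lemma predLaw_univ_le (μ : Measure (E 0)) [IsProbabilityMeasure μ]
    (κ : ∀ t, Kernel (E t) (E (t + 1))) [∀ t, IsMarkovKernel (κ t)] {g : ∀ t, E t → ℝ≥0}
    (hg : ∀ t, Measurable (g t)) (t : ℕ) : predLaw μ κ g t Set.univ ≤ 1 := by
  cases t with
  | zero => simp [predLaw]
  | succ t =>
    simp only [predLaw]
    rw [Measure.bind_apply MeasurableSet.univ (κ t).aemeasurable]
    simpa using posterior_univ_le _ (hg t)

lemma measurable_predLaw {S : Type*} [MeasurableSpace S] (μ : Measure (E 0))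
    [IsProbabilityMeasure μ] (κ : ∀ t, Kernel (E t) (E (t + 1))) [∀ t, IsMarkovKernel (κ t)]
    {g : ∀ t, S → E t → ℝ≥0} (hg : ∀ t, Measurable (Function.uncurry (g t))) (t : ℕ) :
    Measurable fun s => predLaw μ κ (fun t => g t s) t := by
  induction t with
  | zero => exact measurable_const
  | succ t ih =>
    let η : Kernel S (E t) := ⟨_, ih⟩
    have hη : IsFiniteKernel η := ⟨1, ENNReal.one_lt_top, fun s =>
      predLaw_univ_le μ κ (fun t => (hg t).comp measurable_prodMk_left) t⟩
    let π : Kernel S (E t) := ⟨_, measurable_posterior η (hg t)⟩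
    exact (κ t ∘ₖ π).measurable

end PredictiveLaw

/-! ### The reference measure -/

section AtomRef

/-- Counting measure on `A` plus Lebesgue measure. -/
def atomRef (A : Set ℝ) : Measure ℝ := Measure.sum (fun a : A => Measure.dirac (a : ℝ)) + volume

/-- For the discrete part, Aᶜ is null and each singleton of A has mass one; countability of A makes
this a countable cover. -/
lemma sigmaFinite_atomRef {A : Set ℝ} (hA : A.Countable) : SigmaFinite (atomRef A) := by
  have : SigmaFinite (Measure.sum (fun a : A => Measure.dirac (a : ℝ))) := by
    have hc : (insert Aᶜ ((fun a : ℝ => ({a} : Set ℝ)) '' A)).Countable :=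
      (hA.image _).insert _
    refine Measure.sigmaFinite_of_countable hc ?_ ?_
    · rintro s (rfl | ⟨a, ha, rfl⟩)
      · rw [Measure.sum_apply _ hA.measurableSet.compl]
        simp
      · rw [Measure.sum_apply _ (measurableSet_singleton a), tsum_eq_single ⟨a, ha⟩]
        · simp
        · intro b hb
          have : (b : ℝ) ≠ a := fun h => hb (Subtype.ext h)
          simp [this]
    · ext y
      by_cases hy : y ∈ A <;> simp
  unfold atomRef
  infer_instance

end AtomRef

/-! ### Likelihood of the observations -/

namespace MixedSSM

variable {E : ℕ → Type*} [∀ t, MeasurableSpace (E t)] {m : ℕ → ℕ} (M : MixedSSM E m)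

/-- The Lebesgue part has no atoms, so `mass` is a true point probability. Its bound by one and its
measurability in the state, neither of which is part of the model's definition, follow from this. -/
lemma obs_singleton (t : ℕ) (i : Fin (m t)) (x : E t) (y : ℝ) :
    M.obs t i x {y} = M.mass t i x y := by
  rw [M.obs_eq, Measure.add_apply, Measure.sum_apply _ (measurableSet_singleton y),
    withDensity_absolutelyContinuous volume _ (Real.volume_singleton), add_zero,
    tsum_eq_single y]
  · simp
  · intro z hz
    simp [hz]

lemma mass_le_one (t : ℕ) (i : Fin (m t)) (x : E t) (y : ℝ) : M.mass t i x y ≤ 1 := by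
  have := M.isMarkov_obs t i
  have h : M.obs t i x {y} ≤ 1 := prob_le_one
  rw [obs_singleton] at h
  exact_mod_cast h

lemma measurable_mass (t : ℕ) (i : Fin (m t)) (y : ℝ) : Measurable fun x => M.mass t i x y := by
  have h := (M.obs t i).measurable_coe (measurableSet_singleton y)
  simp_rw [obs_singleton] at h
  simpa using h.ennreal_toNNReal

open Classical in
/-- The density of `Y_{t,i}` given `X_t = x` with respect to `atomRef A`. -/
def coordLik (A : Set ℝ) (t : ℕ) (i : Fin (m t)) (y : ℝ) (x : E t) : ℝ≥0 :=
  if y ∈ A then M.mass t i x y else M.dens t i x y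

/-- Point masses are measurable in the state for each fixed value only; joint measurability comes
from splitting over the countably many atoms. -/
lemma measurable_coordLik {A : Set ℝ} (hA : A.Countable) (t : ℕ) (i : Fin (m t)) :
    Measurable (Function.uncurry (M.coordLik A t i)) := by
  intro B hB
  have : Function.uncurry (M.coordLik A t i) ⁻¹' B
      = (⋃ a ∈ A, {p : ℝ × E t | p.1 = a ∧ M.mass t i p.2 a ∈ B}) ∪
        {p : ℝ × E t | p.1 ∉ A ∧ M.dens t i p.2 p.1 ∈ B} := by
    ext ⟨y, x⟩
    by_cases hy : y ∈ A <;> simp [coordLik, Function.uncurry, hy]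
  rw [this]
  refine (MeasurableSet.biUnion hA fun a _ => ?_).union ?_
  · exact (measurable_fst (measurableSet_singleton a)).inter
      (((M.measurable_mass t i a).comp measurable_snd) hB)
  · exact (measurable_fst hA.measurableSet.compl).inter
      (((M.measurable_dens t i).comp measurable_swap) hB)

/-- Atoms outside A carry no mass by `hx`, and replacing the density by the mass on the
Lebesgue-null set A does not affect the continuous part. -/
lemma obs_eq_withDensity {A : Set ℝ} (hA : A.Countable) {t : ℕ} {i : Fin (m t)} {x : E t}
    (hx : ∀ y, y ∉ A → M.mass t i x y = 0) :
    M.obs t i x = (atomRef A).withDensity fun y => M.coordLik A t i y x := by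
  rw [M.obs_eq, atomRef, withDensity_add_measure]
  congr 1
  · ext B hB
    rw [Measure.sum_apply _ hB, withDensity_apply _ hB, ← lintegral_indicator hB,
      lintegral_sum_measure, ← tsum_subtype_eq_of_support_subset (s := A)]
    · refine tsum_congr fun a => ?_
      rw [lintegral_dirac]
      by_cases h : (a : ℝ) ∈ B <;> simp [h, coordLik]
    · intro y hy
      by_contra h
      exact hy (by simp [hx y h])
  · refine withDensity_congr_ae ?_
    have : ∀ᵐ y : ℝ, y ∉ A := measure_eq_zero_iff_ae_notMem.1 (hA.measure_zero volume)
    filter_upwards [this] with y hy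
    simp [coordLik, hy]

/-- The density of `Y_t` given `X_t = x` with respect to the product of the measures
`atomRef (A t i)`. -/
def lik (A : ∀ t, Fin (m t) → Set ℝ) (t : ℕ) (y : Fin (m t) → ℝ) (x : E t) : ℝ≥0 :=
  ∏ i, M.coordLik (A t i) t i (y i) x

lemma measurable_lik {A : ∀ t, Fin (m t) → Set ℝ} (hA : ∀ t i, (A t i).Countable) (t : ℕ) :
    Measurable (Function.uncurry (M.lik A t)) := by
  have e : Function.uncurry (M.lik A t) = fun p => ∏ i, M.coordLik (A t i) t i (p.1 i) p.2 := rfl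
  rw [e]
  refine Finset.measurable_fun_prod (f := fun i (p : (Fin (m t) → ℝ) × E t) =>
    M.coordLik (A t i) t i (p.1 i) p.2) _ fun i _ => ?_
  exact (M.measurable_coordLik (hA t i) t i).comp
    ((show Measurable fun p : (Fin (m t) → ℝ) × E t => p.1 i from
      (measurable_pi_apply i).comp measurable_fst).prodMk measurable_snd)

variable {M} {T : ℕ} {Ω : Type*} [MeasurableSpace Ω] {P : Measure Ω} [IsProbabilityMeasure P]
  {X : ∀ t, Ω → E t} {Y : ∀ t, Ω → Fin (m t) → ℝ}

/-- The `σ`-algebra generated by all states and the observations before time `t`. -/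
abbrev pastSigma (T : ℕ) (X : ∀ t, Ω → E t) (Y : ∀ t, Ω → Fin (m t) → ℝ) (t : ℕ) :
    MeasurableSpace Ω :=
  (⨆ s, ⨆ (_ : s ≤ T), MeasurableSpace.comap (X s) inferInstance) ⊔
    ⨆ s, ⨆ (_ : s < t), MeasurableSpace.comap (Y s) inferInstance

/-- The `σ`-algebra generated by all variables except `Y_{t,a}`. -/
abbrev othersSigma (T : ℕ) (X : ∀ t, Ω → E t) (Y : ∀ t, Ω → Fin (m t) → ℝ) (t : ℕ)
    (a : Fin (m t)) : MeasurableSpace Ω :=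
  (⨆ s, ⨆ (_ : s ≤ T), MeasurableSpace.comap (X s) inferInstance) ⊔
    ⨆ q : Σ s, Fin (m s), ⨆ (_ : q.1 ≤ T ∧ q ≠ ⟨t, a⟩),
      MeasurableSpace.comap (fun ω => Y q.1 ω q.2) inferInstance

namespace Represents

/-- Conditional independence of the coordinates of Y_t. They are integrated out one at a time,
conditioning on all other variables; the resulting factor depends on X_t only and is absorbed into
`U`, which is why `U` is general in the induction. -/
lemma lintegral_prod_obs (hXY : M.Represents T P X Y) {t : ℕ} (ht : t ≤ T)
    {C : Fin (m t) → Set ℝ} (hC : ∀ i, MeasurableSet (C i)) (S : Finset (Fin (m t))) :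
    ∀ U : Ω → ℝ≥0∞, Measurable[pastSigma T X Y t] U →
    ∫⁻ ω, U ω * ∏ i ∈ S, (C i).indicator 1 (Y t ω i) ∂P
      = ∫⁻ ω, U ω * ∏ i ∈ S, M.obs t i (X t ω) (C i) ∂P := by
  classical
  induction S using Finset.induction_on with
  | empty => simp
  | insert a S ha ih =>
    intro U hU
    have hYo : ∀ q : Σ s, Fin (m s), q.1 ≤ T → q ≠ ⟨t, a⟩ →
        Measurable[othersSigma T X Y t a] fun ω => Y q.1 ω q.2 := by
      intro q h1 h2
      refine (comap_measurable _).mono ?_ le_rfl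
      refine le_trans ?_ le_sup_right
      exact le_iSup_of_le q (le_iSup_of_le ⟨h1, h2⟩ le_rfl)
    have hpast : pastSigma T X Y t ≤ othersSigma T X Y t a := by
      refine sup_le le_sup_left (iSup_le fun s => iSup_le fun hs => ?_)
      refine Measurable.comap_le ?_
      refine @measurable_pi_lambda Ω _ _ (othersSigma T X Y t a) _ _ fun i => hYo ⟨s, i⟩ (by simp only; omega) ?_
      intro h
      have : s = t := congrArg Sigma.fst h
      omega
    have hle : othersSigma T X Y t a ≤ ‹MeasurableSpace Ω› := by
      refine sup_le (iSup_le fun s => iSup_le fun hs => (hXY.measurable_X s hs).comap_le)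
        (iSup_le fun q => iSup_le fun hq => ?_)
      exact ((measurable_pi_apply q.2).comp (hXY.measurable_Y q.1 hq.1)).comap_le
    have hXt : Measurable[pastSigma T X Y t] (X t) := by
      refine (comap_measurable _).mono ?_ le_rfl
      refine le_trans ?_ le_sup_left
      exact le_iSup_of_le t (le_iSup_of_le ht le_rfl)
    have hobs : Measurable[pastSigma T X Y t] fun ω => M.obs t a (X t ω) (C a) :=
      ((M.obs t a).measurable_coe (hC a)).comp hXt
    have hU' : Measurable[othersSigma T X Y t a] fun ω => U ω * ∏ i ∈ S, (C i).indicator 1 (Y t ω i) := by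
      refine (hU.mono hpast le_rfl).mul (Finset.measurable_fun_prod _ fun i hi => ?_)
      refine (measurable_one.indicator (hC i)).comp (hYo ⟨t, i⟩ ht ?_)
      rintro h
      simp only [Sigma.mk.injEq, heq_eq_eq, true_and] at h
      exact ha (h ▸ hi)
    have hV : MeasurableSet ((fun ω => Y t ω a) ⁻¹' (C a)) :=
      ((measurable_pi_apply a).comp (hXY.measurable_Y t ht)) (hC a)
    have key := lintegral_mul_indicator_eq_condExp (P := P) hle hV hU'
    have := M.isMarkov_obs t a
    calc ∫⁻ ω, U ω * ∏ i ∈ insert a S, (C i).indicator 1 (Y t ω i) ∂P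
        = ∫⁻ ω, (U ω * ∏ i ∈ S, (C i).indicator 1 (Y t ω i)) *
            ((fun ω => Y t ω a) ⁻¹' (C a)).indicator 1 ω ∂P := by
          refine lintegral_congr fun ω => ?_
          rw [Finset.prod_insert ha, mul_comm ((C a).indicator 1 (Y t ω a)), mul_assoc]
          rfl
      _ = ∫⁻ ω, (U ω * M.obs t a (X t ω) (C a)) * ∏ i ∈ S, (C i).indicator 1 (Y t ω i) ∂P := by
          rw [key]
          refine lintegral_congr_ae ?_
          filter_upwards [hXY.obs t ht a (C a) (hC a)] with ω hω
          rw [hω, ofReal_measureReal]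
          ring
      _ = ∫⁻ ω, U ω * ∏ i ∈ insert a S, M.obs t i (X t ω) (C i) ∂P := by
          rw [ih (fun ω => U ω * M.obs t a (X t ω) (C a)) (hU.mul hobs)]
          refine lintegral_congr fun ω => ?_
          rw [Finset.prod_insert ha]
          ring

/-- On boxes this is `lintegral_prod_obs` combined with the coordinate densities. Both sides are
finite measures in C, so the π-system of boxes determines them. -/
lemma lintegral_lik (hXY : M.Represents T P X Y) {A : ∀ t, Fin (m t) → Set ℝ}
    (hA : ∀ t i, (A t i).Countable) {t : ℕ} (ht : t ≤ T)
    (hatoms : ∀ i, ∀ᵐ ω ∂P, ∀ y, y ∉ A t i → M.mass t i (X t ω) y = 0)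
    {D : Set Ω} (hD : MeasurableSet[pastSigma T X Y t] D) {C : Set (Fin (m t) → ℝ)}
    (hC : MeasurableSet C) :
    P (D ∩ Y t ⁻¹' C)
      = ∫⁻ ω in D, ∫⁻ y in C, M.lik A t y (X t ω) ∂(Measure.pi fun i => atomRef (A t i)) ∂P := by
  have hσ : ∀ i, SigmaFinite (atomRef (A t i)) := fun i => sigmaFinite_atomRef (hA t i)
  have hDm : MeasurableSet D := by
    refine (sup_le (iSup_le fun s => iSup_le fun hs => (hXY.measurable_X s hs).comap_le)
      (iSup_le fun s => iSup_le fun hs => ?_) : pastSigma T X Y t ≤ _) _ hD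
    exact (hXY.measurable_Y s (by omega)).comap_le
  have hX := hXY.measurable_X t ht
  have hY := hXY.measurable_Y t ht
  set ρ := Measure.pi fun i => atomRef (A t i) with hρ
  have hL : Measurable fun p : Ω × (Fin (m t) → ℝ) => (M.lik A t p.2 (X t p.1) : ℝ≥0∞) :=
    ((M.measurable_lik hA t).comp (measurable_snd.prodMk (hX.comp measurable_fst))).coe_nnreal_ennreal
  have hrect : ∀ B : Fin (m t) → Set ℝ, (∀ i, MeasurableSet (B i)) →
      P (D ∩ Y t ⁻¹' (Set.univ.pi B))
        = ∫⁻ ω in D, ∫⁻ y in Set.univ.pi B, M.lik A t y (X t ω) ∂ρ ∂P := by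
    intro B hB
    have h := hXY.lintegral_prod_obs ht hB Finset.univ (D.indicator 1)
      ((@measurable_const ℝ≥0∞ Ω _ (pastSigma T X Y t) 1).indicator hD)
    have e1 : ∀ ω, D.indicator (1 : Ω → ℝ≥0∞) ω * ∏ i, (B i).indicator 1 (Y t ω i)
        = (D ∩ Y t ⁻¹' (Set.univ.pi B)).indicator 1 ω := by
      intro ω
      by_cases hω : Y t ω ∈ Set.univ.pi B
      · rw [Finset.prod_eq_one fun i _ => by rw [Set.indicator_of_mem (hω i trivial)]; rfl, mul_one]
        by_cases hd : ω ∈ D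
        · rw [Set.indicator_of_mem hd, Set.indicator_of_mem (show ω ∈ D ∩ Y t ⁻¹' (Set.univ.pi B) from ⟨hd, hω⟩)]
        · rw [Set.indicator_of_notMem hd, Set.indicator_of_notMem fun h => hd h.1]
      · have : ∃ i, Y t ω i ∉ B i := by
          simpa [Set.mem_pi] using hω
        obtain ⟨i, hi⟩ := this
        rw [Finset.prod_eq_zero (Finset.mem_univ i) (Set.indicator_of_notMem hi _), mul_zero,
          Set.indicator_of_notMem fun h => hω h.2]
    simp_rw [e1] at h
    rw [lintegral_indicator_one (hDm.inter (hY (MeasurableSet.univ_pi hB)))] at h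
    rw [h, ← lintegral_indicator hDm]
    refine lintegral_congr_ae ?_
    filter_upwards [ae_all_iff.2 hatoms] with ω hω
    by_cases hd : ω ∈ D
    swap
    · simp [hd]
    rw [Set.indicator_of_mem hd, Set.indicator_of_mem hd, Pi.one_apply, one_mul]
    have ho : ∀ i, M.obs t i (X t ω)
        = (atomRef (A t i)).withDensity fun y => M.coordLik (A t i) t i y (X t ω) :=
      fun i => M.obs_eq_withDensity (hA t i) (hω i)
    have hp : ∀ i, IsProbabilityMeasure
        ((atomRef (A t i)).withDensity fun y => (M.coordLik (A t i) t i y (X t ω) : ℝ≥0∞)) := by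
      intro i
      have := M.isMarkov_obs t i
      rw [← ho]
      infer_instance
    simp_rw [ho]
    rw [← Measure.pi_pi, pi_withDensity _ _ fun i => ?_,
      withDensity_apply _ (MeasurableSet.univ_pi hB)]
    · simp [lik, hρ]
    · exact ((M.measurable_coordLik (hA t i) t i).comp measurable_prodMk_right).coe_nnreal_ennreal
  have hswap : ∀ B : Set (Fin (m t) → ℝ), MeasurableSet B →
      (ρ.withDensity fun y => ∫⁻ ω in D, M.lik A t y (X t ω) ∂P) B
        = ∫⁻ ω in D, ∫⁻ y in B, M.lik A t y (X t ω) ∂ρ ∂P := by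
    intro B hB
    rw [withDensity_apply _ hB]
    exact lintegral_lintegral_swap (hL.comp measurable_swap).aemeasurable
  have hmeas : (P.restrict D).map (Y t)
      = ρ.withDensity fun y => ∫⁻ ω in D, M.lik A t y (X t ω) ∂P := by
    refine ext_of_generate_finite _ generateFrom_pi.symm isPiSystem_pi ?_ ?_
    · rintro s ⟨B, hB, rfl⟩
      have hB' : ∀ i, MeasurableSet (B i) := fun i => hB i trivial
      rw [hswap _ (MeasurableSet.univ_pi hB'), ← hrect B hB',
        Measure.map_apply hY (MeasurableSet.univ_pi hB'),
        Measure.restrict_apply (hY (MeasurableSet.univ_pi hB')), Set.inter_comm]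
    · have := hrect (fun _ => Set.univ) fun _ => MeasurableSet.univ
      rw [Set.pi_univ] at this
      rw [hswap _ MeasurableSet.univ, ← this, Measure.map_apply hY MeasurableSet.univ,
        Measure.restrict_apply (hY MeasurableSet.univ), Set.inter_comm]
  rw [← hswap C hC, ← hmeas, Measure.map_apply hY hC, Measure.restrict_apply (hY hC),
    Set.inter_comm]

end Represents

end MixedSSM

/-! ### The filter recursion computes the conditional laws -/

namespace MixedSSM

variable {E : ℕ → Type*} [∀ t, MeasurableSpace (E t)] {m : ℕ → ℕ} (M : MixedSSM E m)

instance : IsProbabilityMeasure M.init := M.isProb_init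

instance (t : ℕ) : IsMarkovKernel (M.trans t) := M.isMarkov_trans t

/-- The predictive law of `X_t` as a function of the observations. -/
def pred (A : ∀ t, Fin (m t) → Set ℝ) (t : ℕ) (y : ∀ s, Fin (m s) → ℝ) : Measure (E t) :=
  predLaw M.init M.trans (fun s => M.lik A s (y s)) t

/-- The filtering law of `X_t` as a function of the observations. -/
def filt (A : ∀ t, Fin (m t) → Set ℝ) (t : ℕ) (y : ∀ s, Fin (m s) → ℝ) : Measure (E t) :=
  posterior (M.pred A t y) (M.lik A t (y t))

lemma pred_congr (A : ∀ t, Fin (m t) → Set ℝ) (t : ℕ) {y y' : ∀ s, Fin (m s) → ℝ}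
    (h : ∀ s < t, y s = y' s) : M.pred A t y = M.pred A t y' :=
  predLaw_congr _ _ t fun s hs => by rw [h s hs]

lemma filt_congr (A : ∀ t, Fin (m t) → Set ℝ) (t : ℕ) {y y' : ∀ s, Fin (m s) → ℝ}
    (h : ∀ s ≤ t, y s = y' s) : M.filt A t y = M.filt A t y' := by
  rw [filt, filt, M.pred_congr A t fun s hs => h s hs.le, h t le_rfl]

variable {A : ∀ t, Fin (m t) → Set ℝ}

lemma measurable_lik_apply (hA : ∀ t i, (A t i).Countable) (t : ℕ) (y : Fin (m t) → ℝ) :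
    Measurable (M.lik A t y) :=
  (M.measurable_lik hA t).comp measurable_prodMk_left

lemma measurable_lik_eval (hA : ∀ t i, (A t i).Countable) (t : ℕ) :
    Measurable (Function.uncurry fun (y : ∀ s, Fin (m s) → ℝ) x => M.lik A t (y t) x) :=
  (M.measurable_lik hA t).comp
    ((show Measurable fun p : (∀ s, Fin (m s) → ℝ) × E t => p.1 t from
      (measurable_pi_apply t).comp measurable_fst).prodMk measurable_snd)

/-- The predictive law as a kernel. -/
def predKernel (hA : ∀ t i, (A t i).Countable) (t : ℕ) :
    Kernel (∀ s, Fin (m s) → ℝ) (E t) :=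
  ⟨M.pred A t, measurable_predLaw _ _ (M.measurable_lik_eval hA) t⟩

instance (hA : ∀ t i, (A t i).Countable) (t : ℕ) : IsFiniteKernel (M.predKernel hA t) :=
  ⟨1, ENNReal.one_lt_top, fun y => predLaw_univ_le _ _ (fun s => M.measurable_lik_apply hA s (y s)) t⟩

/-- The filtering law as a kernel. -/
def filtKernel (hA : ∀ t i, (A t i).Countable) (t : ℕ) :
    Kernel (∀ s, Fin (m s) → ℝ) (E t) :=
  ⟨M.filt A t, measurable_posterior (M.predKernel hA t) (M.measurable_lik_eval hA t)⟩

instance (hA : ∀ t i, (A t i).Countable) (t : ℕ) : IsFiniteKernel (M.filtKernel hA t) :=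
  ⟨1, ENNReal.one_lt_top, fun y => posterior_univ_le _ (M.measurable_lik_apply hA t (y t))⟩

/-- The observations before time `t`, padded by `0`. -/
def hist {Ω : Type*} (Y : ∀ t, Ω → Fin (m t) → ℝ) (t : ℕ) (ω : Ω) : ∀ s, Fin (m s) → ℝ :=
  fun s => if s < t then Y s ω else 0

lemma measurable_hist {Ω : Type*} {mΩ : MeasurableSpace Ω} {Y : ∀ t, Ω → Fin (m t) → ℝ} {t : ℕ}
    (h : ∀ s < t, Measurable (Y s)) : Measurable (hist Y t) := by
  refine measurable_pi_lambda _ fun s => ?_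
  by_cases hs : s < t
  · simpa only [hist, hs, if_true] using h s hs
  · simpa only [hist, hs, if_false] using measurable_const

lemma hist_succ {Ω : Type*} (Y : ∀ t, Ω → Fin (m t) → ℝ) (t : ℕ) (ω : Ω) :
    hist Y (t + 1) ω = Function.update (hist Y t ω) t (Y t ω) := by
  ext1 s
  by_cases hs : s = t
  · subst hs
    simp [hist]
  · rw [Function.update_of_ne hs]
    have : s < t + 1 ↔ s < t := by omega
    simp only [hist, this]

lemma pred_hist {Ω : Type*} (Y : ∀ t, Ω → Fin (m t) → ℝ) (t : ℕ) (ω : Ω) :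
    M.pred A t (hist Y t ω) = M.pred A t (fun s => Y s ω) :=
  M.pred_congr A t fun s hs => by simp [hist, hs]

lemma filt_hist {Ω : Type*} (Y : ∀ t, Ω → Fin (m t) → ℝ) (t : ℕ) (ω : Ω) :
    M.filt A t (hist Y (t + 1) ω) = M.filt A t (fun s => Y s ω) :=
  M.filt_congr A t fun s hs => by simp [hist, Nat.lt_succ_of_le hs]

namespace Represents

variable {M} {T : ℕ} {Ω : Type*} [MeasurableSpace Ω] {P : Measure Ω} [IsProbabilityMeasure P]
  {X : ∀ t, Ω → E t} {Y : ∀ t, Ω → Fin (m t) → ℝ}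

omit [IsProbabilityMeasure P] in
lemma measurable_hist (hXY : M.Represents T P X Y) {t : ℕ} (ht : t ≤ T + 1) :
    Measurable (hist Y t) :=
  MixedSSM.measurable_hist fun s hs => hXY.measurable_Y s (by omega)

lemma law_hist_zero (hXY : M.Represents T P X Y) (hA : ∀ t i, (A t i).Countable) :
    P.map (fun ω => (hist Y 0 ω, X 0 ω)) = (P.map (hist Y 0)) ⊗ₘ M.predKernel hA 0 := by
  have hH : Measurable (hist Y 0) := hXY.measurable_hist (by omega)
  have hX := hXY.measurable_X 0 (by omega)
  have : IsProbabilityMeasure (P.map (hist Y 0)) :=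
    Measure.isProbabilityMeasure_map hH.aemeasurable
  refine Measure.ext_prod fun {B C} hB hC => ?_
  have e : hist Y 0 = fun _ => 0 := by
    ext ω s : 2
    simp [hist]
  have hk : ∀ y, M.predKernel hA 0 y = M.init := fun y => rfl
  rw [Measure.compProd_apply_prod hB hC, Measure.map_apply (hH.prodMk hX) (hB.prod hC)]
  simp_rw [hk]
  rw [setLIntegral_const, Measure.map_apply hH hB, ← hXY.init, Measure.map_apply hX hC, e]
  by_cases h0 : (0 : ∀ s, Fin (m s) → ℝ) ∈ B
  · have : (fun ω => ((0 : ∀ s, Fin (m s) → ℝ), X 0 ω)) ⁻¹' B ×ˢ C = X 0 ⁻¹' C := by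
      ext ω; simp [h0]
    rw [this]
    simp [h0]
  · have : (fun ω => ((0 : ∀ s, Fin (m s) → ℝ), X 0 ω)) ⁻¹' B ×ˢ C = ∅ := by
      ext ω; simp [h0]
    rw [this]
    simp [h0]

/-- Correction step: Bayes' formula with the history before t as H, Y_t as V and the predictive law
as prior. The new history is a measurable function of (H, V). -/
lemma law_hist_succ_of_law_hist (hXY : M.Represents T P X Y) (hA : ∀ t i, (A t i).Countable)
    {t : ℕ} (ht : t ≤ T) (hatoms : ∀ i, ∀ᵐ ω ∂P, ∀ y, y ∉ A t i → M.mass t i (X t ω) y = 0)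
    (hL : P.map (fun ω => (hist Y t ω, X t ω)) = (P.map (hist Y t)) ⊗ₘ M.predKernel hA t) :
    (∀ᵐ ω ∂P, ∫⁻ x, M.lik A t (Y t ω) x ∂(M.pred A t fun s => Y s ω) ≠ 0 ∧
      ∫⁻ x, M.lik A t (Y t ω) x ∂(M.pred A t fun s => Y s ω) ≠ ∞) ∧
    P.map (fun ω => (hist Y (t + 1) ω, X t ω))
      = (P.map (hist Y (t + 1))) ⊗ₘ M.filtKernel hA t := by
  have hH := hXY.measurable_hist (t := t) (by omega)
  have hH' := hXY.measurable_hist (t := t + 1) (by omega)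
  have hX := hXY.measurable_X t ht
  have hY := hXY.measurable_Y t ht
  have hσ : ∀ i, SigmaFinite (atomRef (A t i)) := fun i => sigmaFinite_atomRef (hA t i)
  have hXp : Measurable[pastSigma T X Y t] (X t) := by
    refine (comap_measurable _).mono ?_ le_rfl
    refine le_trans ?_ le_sup_left
    exact le_iSup_of_le t (le_iSup_of_le ht le_rfl)
  have hHp : Measurable[pastSigma T X Y t] (hist Y t) := by
    refine MixedSSM.measurable_hist (mΩ := pastSigma T X Y t) fun s hs => ?_
    refine (comap_measurable _).mono ?_ le_rfl
    refine le_trans ?_ le_sup_right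
    exact le_iSup_of_le s (le_iSup_of_le hs le_rfl)
  obtain ⟨h1, h2⟩ := bayes hH hY hX (Measure.pi fun i => atomRef (A t i)) (M.predKernel hA t)
    (M.measurable_lik hA t) hL fun B C D hB hC hD =>
      hXY.lintegral_lik hA ht hatoms ((hHp hB).inter (hXp hC)) hD
  have hpred : ∀ ω, M.predKernel hA t (hist Y t ω) = M.pred A t fun s => Y s ω :=
    fun ω => M.pred_hist Y t ω
  simp_rw [hpred] at h1 h2
  refine ⟨h1, ?_⟩
  have : IsProbabilityMeasure (P.map (hist Y (t + 1))) :=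
    Measure.isProbabilityMeasure_map hH'.aemeasurable
  refine Measure.ext_prod fun {B C} hB hC => ?_
  have hfilt : ∀ ω, M.filtKernel hA t (hist Y (t + 1) ω) C
      = posterior (M.pred A t fun s => Y s ω) (M.lik A t (Y t ω)) C := by
    intro ω
    have : M.filtKernel hA t (hist Y (t + 1) ω) = M.filt A t (fun s => Y s ω) :=
      M.filt_hist Y t ω
    rw [this]
    rfl
  rw [Measure.compProd_apply_prod hB hC, Measure.map_apply (hH'.prodMk hX) (hB.prod hC),
    setLIntegral_map hB (Kernel.measurable_coe _ hC) hH']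
  simp_rw [hfilt]
  have hF : Measurable fun p : (∀ s, Fin (m s) → ℝ) × (Fin (m t) → ℝ) =>
      Function.update p.1 t p.2 := by
    refine measurable_pi_lambda _ fun s => ?_
    by_cases hs : s = t
    · subst hs
      simpa using measurable_snd
    · simp only [Function.update_of_ne hs]
      exact (measurable_pi_apply s).comp measurable_fst
  have e : ∀ S : Set (∀ s, Fin (m s) → ℝ), hist Y (t + 1) ⁻¹' S
      = (fun ω => (hist Y t ω, Y t ω)) ⁻¹' ((fun p : (∀ s, Fin (m s) → ℝ) × (Fin (m t) → ℝ) =>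
        Function.update p.1 t p.2) ⁻¹' S) := by
    intro S
    ext ω
    simp only [Set.mem_preimage, hist_succ]
  rw [e, ← h2 _ _ (hF hB) hC, ← e]
  rfl

/-- Prediction step: given past states and observations X_{t+1} follows the transition kernel at
X_t, and X_t is averaged over the filtering law. -/
lemma law_hist_of_law_hist_succ (hXY : M.Represents T P X Y) (hA : ∀ t i, (A t i).Countable)
    {t : ℕ} (ht : t < T)
    (hL : P.map (fun ω => (hist Y (t + 1) ω, X t ω))
      = (P.map (hist Y (t + 1))) ⊗ₘ M.filtKernel hA t) :
    P.map (fun ω => (hist Y (t + 1) ω, X (t + 1) ω))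
      = (P.map (hist Y (t + 1))) ⊗ₘ M.predKernel hA (t + 1) := by
  have hH := hXY.measurable_hist (t := t + 1) (by omega)
  have hX := hXY.measurable_X t ht.le
  have hX' := hXY.measurable_X (t + 1) ht
  have : IsProbabilityMeasure (P.map (hist Y (t + 1))) :=
    Measure.isProbabilityMeasure_map hH.aemeasurable
  have hle : (⨆ s, ⨆ (_ : s ≤ t), MeasurableSpace.comap (X s) inferInstance ⊔
      MeasurableSpace.comap (Y s) inferInstance) ≤ ‹MeasurableSpace Ω› :=
    iSup_le fun s => iSup_le fun hs => sup_le (hXY.measurable_X s (by omega)).comap_le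
      (hXY.measurable_Y s (by omega)).comap_le
  have hHp : Measurable[⨆ s, ⨆ (_ : s ≤ t), MeasurableSpace.comap (X s) inferInstance ⊔
      MeasurableSpace.comap (Y s) inferInstance] (hist Y (t + 1)) := by
    refine MixedSSM.measurable_hist (mΩ := ⨆ s, ⨆ (_ : s ≤ t),
      MeasurableSpace.comap (X s) inferInstance ⊔ MeasurableSpace.comap (Y s) inferInstance)
      fun s hs => ?_
    refine (comap_measurable _).mono ?_ le_rfl
    exact le_iSup_of_le s (le_iSup_of_le (by omega) le_sup_right)
  refine Measure.ext_prod fun {B C} hB hC => ?_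
  have key := lintegral_mul_indicator_eq_condExp (P := P) hle (hX' hC)
    (U := (hist Y (t + 1) ⁻¹' B).indicator fun _ => 1) (measurable_const.indicator (hHp hB))
  rw [Measure.compProd_apply_prod hB hC, Measure.map_apply (hH.prodMk hX') (hB.prod hC)]
  have hκ : Measurable fun p : (∀ s, Fin (m s) → ℝ) × E t => M.trans t p.2 C :=
    (Kernel.measurable_coe _ hC).comp measurable_snd
  calc P ((fun ω => (hist Y (t + 1) ω, X (t + 1) ω)) ⁻¹' B ×ˢ C)
      = ∫⁻ ω, (hist Y (t + 1) ⁻¹' B).indicator (fun _ => 1) ω *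
          (X (t + 1) ⁻¹' C).indicator 1 ω ∂P := by
        rw [← lintegral_indicator_one ((hH.prodMk hX') (hB.prod hC))]
        refine lintegral_congr fun ω => ?_
        by_cases h1 : hist Y (t + 1) ω ∈ B <;> by_cases h2 : X (t + 1) ω ∈ C <;> simp [h1, h2]
    _ = ∫⁻ ω in hist Y (t + 1) ⁻¹' B, M.trans t (X t ω) C ∂P := by
        rw [key, ← lintegral_indicator (hH hB)]
        refine lintegral_congr_ae ?_
        filter_upwards [hXY.trans t ht C hC] with ω hω
        rw [hω, ofReal_measureReal]
        by_cases h1 : hist Y (t + 1) ω ∈ B <;> simp [h1]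
    _ = ∫⁻ p in B ×ˢ Set.univ, M.trans t p.2 C ∂(P.map fun ω => (hist Y (t + 1) ω, X t ω)) := by
        rw [setLIntegral_map (hB.prod MeasurableSet.univ)
          hκ (hH.prodMk hX)]
        congr 2
        ext ω
        simp
    _ = ∫⁻ h in B, ∫⁻ x, M.trans t x C ∂(M.filtKernel hA t h) ∂(P.map (hist Y (t + 1))) := by
        rw [hL, ← lintegral_indicator (hB.prod MeasurableSet.univ),
          Measure.lintegral_compProd (hκ.indicator (hB.prod MeasurableSet.univ)), ← lintegral_indicator hB]
        refine lintegral_congr fun h => ?_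
        by_cases hh : h ∈ B <;> simp [hh]
    _ = ∫⁻ h in B, M.predKernel hA (t + 1) h C ∂(P.map (hist Y (t + 1))) := by
        refine lintegral_congr fun h => ?_
        exact (Measure.bind_apply hC (M.trans t).aemeasurable).symm

lemma law_hist (hXY : M.Represents T P X Y) (hA : ∀ t i, (A t i).Countable)
    (hatoms : ∀ t ≤ T, ∀ i, ∀ᵐ ω ∂P, ∀ y, y ∉ A t i → M.mass t i (X t ω) y = 0) {t : ℕ}
    (ht : t ≤ T) :
    P.map (fun ω => (hist Y t ω, X t ω)) = (P.map (hist Y t)) ⊗ₘ M.predKernel hA t := by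
  induction t with
  | zero => exact hXY.law_hist_zero hA
  | succ t ih =>
    exact hXY.law_hist_of_law_hist_succ hA ht
      (hXY.law_hist_succ_of_law_hist hA (by omega) (hatoms t (by omega)) (ih (by omega))).2

lemma ae_normalizer (hXY : M.Represents T P X Y) (hA : ∀ t i, (A t i).Countable)
    (hatoms : ∀ t ≤ T, ∀ i, ∀ᵐ ω ∂P, ∀ y, y ∉ A t i → M.mass t i (X t ω) y = 0) {t : ℕ}
    (ht : t ≤ T) :
    ∀ᵐ ω ∂P, ∫⁻ x, M.lik A t (Y t ω) x ∂(M.pred A t fun s => Y s ω) ≠ 0 ∧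
      ∫⁻ x, M.lik A t (Y t ω) x ∂(M.pred A t fun s => Y s ω) ≠ ∞ :=
  (hXY.law_hist_succ_of_law_hist hA ht (hatoms t ht) (hXY.law_hist hA hatoms ht)).1

/-- The padded history generates `obsSigma Y t`, and the filtering kernel disintegrates the joint
law of history and state; integration against it therefore has the defining property of the
conditional expectation. -/
lemma condExp_eq_integral_filt (hXY : M.Represents T P X Y) (hA : ∀ t i, (A t i).Countable)
    (hatoms : ∀ t ≤ T, ∀ i, ∀ᵐ ω ∂P, ∀ y, y ∉ A t i → M.mass t i (X t ω) y = 0) {t : ℕ}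
    (ht : t ≤ T) {φ : E t → ℝ} (hφ : Measurable φ) (hint : Integrable (fun ω => φ (X t ω)) P) :
    P[fun ω => φ (X t ω) | obsSigma Y t] =ᵐ[P] fun ω => ∫ x, φ x ∂(M.filt A t fun s => Y s ω) := by
  have hL := (hXY.law_hist_succ_of_law_hist hA ht (hatoms t ht) (hXY.law_hist hA hatoms ht)).2
  have hH := hXY.measurable_hist (t := t + 1) (by omega)
  have hX := hXY.measurable_X t ht
  have : IsProbabilityMeasure (P.map (hist Y (t + 1))) :=
    Measure.isProbabilityMeasure_map hH.aemeasurable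
  have hle : obsSigma Y t ≤ ‹MeasurableSpace Ω› :=
    iSup_le fun s => iSup_le fun hs => (hXY.measurable_Y s (by omega)).comap_le
  have hHp : Measurable[obsSigma Y t] (hist Y (t + 1)) := by
    refine MixedSSM.measurable_hist (mΩ := obsSigma Y t) fun s hs => ?_
    refine (comap_measurable _).mono ?_ le_rfl
    exact le_iSup_of_le s (le_iSup_of_le (by omega) le_rfl)
  have hcomap : obsSigma Y t ≤ MeasurableSpace.comap (hist Y (t + 1)) inferInstance := by
    refine iSup_le fun s => iSup_le fun hs => ?_
    have : Y s = (fun y : ∀ s, Fin (m s) → ℝ => y s) ∘ hist Y (t + 1) := by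
      ext1 ω
      simp [hist, Nat.lt_succ_of_le hs]
    rw [this, ← MeasurableSpace.comap_comp]
    exact MeasurableSpace.comap_mono (measurable_pi_apply s).comap_le
  have hφm : StronglyMeasurable fun p : (∀ s, Fin (m s) → ℝ) × E t => φ p.2 :=
    (hφ.comp measurable_snd).stronglyMeasurable
  have hint' : Integrable (fun p : (∀ s, Fin (m s) → ℝ) × E t => φ p.2)
      ((P.map (hist Y (t + 1))) ⊗ₘ M.filtKernel hA t) := by
    rw [← hL, integrable_map_measure hφm.aestronglyMeasurable (hH.prodMk hX).aemeasurable]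
    exact hint
  set G : (∀ s, Fin (m s) → ℝ) → ℝ := fun y => ∫ x, φ x ∂(M.filtKernel hA t y) with hG
  have hGm : StronglyMeasurable G :=
    StronglyMeasurable.integral_kernel_prod_right (f := fun _ x => φ x) hφm
  have hGint : Integrable G (P.map (hist Y (t + 1))) :=
    ((Measure.integrable_compProd_iff hφm.aestronglyMeasurable).1 hint').2.mono'
      hGm.aestronglyMeasurable (ae_of_all _ fun y => norm_integral_le_integral_norm _)
  have hGω : ∀ ω, G (hist Y (t + 1) ω) = ∫ x, φ x ∂(M.filt A t fun s => Y s ω) := by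
    intro ω
    have : M.filtKernel hA t (hist Y (t + 1) ω) = M.filt A t (fun s => Y s ω) :=
      M.filt_hist Y t ω
    rw [hG, ← this]
  simp_rw [← hGω]
  symm
  refine ae_eq_condExp_of_forall_setIntegral_eq hle hint
    (fun s _ _ => (hGint.comp_measurable hH).integrableOn) (fun s hs _ => ?_)
    (hGm.comp_measurable hHp).aestronglyMeasurable
  obtain ⟨B, hB, rfl⟩ := hcomap s hs
  rw [← setIntegral_map (f := G) hB hGm.aestronglyMeasurable hH.aemeasurable]
  have e : hist Y (t + 1) ⁻¹' B = (fun ω => (hist Y (t + 1) ω, X t ω)) ⁻¹' (B ×ˢ Set.univ) := by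
    ext ω; simp
  rw [e, ← setIntegral_map (f := fun p : (∀ s, Fin (m s) → ℝ) × E t => φ p.2)
    (hB.prod MeasurableSet.univ) hφm.aestronglyMeasurable (hH.prodMk hX).aemeasurable, hL,
    Measure.setIntegral_compProd hB MeasurableSet.univ hint'.integrableOn]
  simp [hG]

end Represents

end MixedSSM

/-! ### Lexicographic weights are likelihoods -/

lemma foldl_lexUpdate {ι : Type*} (F f : ι → ℝ≥0) (l : List ι) (p : ℕ × ℝ≥0) :
    l.foldl (fun p i => lexUpdate p (F i) (f i)) p
      = (p.1 + (l.map fun i => if 0 < F i then 0 else 1).sum,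
          p.2 * (l.map fun i => if 0 < F i then F i else f i).prod) := by
  induction l generalizing p with
  | nil => simp
  | cons a l ih =>
    rw [List.foldl_cons, ih]
    by_cases h : 0 < F a
    · simp only [lexUpdate, h, if_true, List.map_cons, List.sum_cons, List.prod_cons, zero_add,
        mul_assoc]
    · simp only [lexUpdate, h, if_false, List.map_cons, List.sum_cons, List.prod_cons, mul_assoc,
        add_assoc]

namespace MixedSSM

variable {E : ℕ → Type*} [∀ t, MeasurableSpace (E t)] {m : ℕ → ℕ} (M : MixedSSM E m)

lemma lexWeight_eq (t : ℕ) (y : Fin (m t) → ℝ) (x : E t) :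
    M.lexWeight t y x = (∑ i, if 0 < M.mass t i x (y i) then 0 else 1,
      ∏ i, if 0 < M.mass t i x (y i) then M.mass t i x (y i) else M.dens t i x (y i)) := by
  rw [lexWeight, foldl_lexUpdate (fun i => M.mass t i x (y i)) (fun i => M.dens t i x (y i)),
    zero_add, one_mul, Fin.sum_univ_def, Fin.prod_univ_def]

variable {A : ∀ t, Fin (m t) → Set ℝ}

open Classical in
-- Compare coordinatewise. Off the atom set the mass is zero, so the coordinate counts towards d. On
-- it, the coordinate counts only if the mass is zero, and then the likelihood has a zero factor.
-- Without such an excess the two products agree factor by factor.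
lemma lexWeight_of_mass_eq_zero {t : ℕ} {y : Fin (m t) → ℝ} {x : E t}
    (hx : ∀ i, y i ∉ A t i → M.mass t i x (y i) = 0) :
    (∑ i, if y i ∈ A t i then 0 else 1) ≤ (M.lexWeight t y x).1 ∧
    ((M.lexWeight t y x).1 = (∑ i, if y i ∈ A t i then 0 else 1) →
      (M.lexWeight t y x).2 = M.lik A t y x) ∧
    ((M.lexWeight t y x).1 ≠ (∑ i, if y i ∈ A t i then 0 else 1) → M.lik A t y x = 0) := by
  rw [lexWeight_eq]
  have hle : ∀ i ∈ Finset.univ, (if y i ∈ A t i then 0 else 1)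
      ≤ (if 0 < M.mass t i x (y i) then 0 else 1) := by
    intro i _
    by_cases h : y i ∈ A t i
    · simp [h]
    · simp [h, hx i h]
  refine ⟨Finset.sum_le_sum hle, fun h => ?_, fun h => ?_⟩
  · have h' := (Finset.sum_eq_sum_iff_of_le hle).1 h.symm
    simp only [lik]
    refine Finset.prod_congr rfl fun i hi => ?_
    have := h' i hi
    by_cases h1 : y i ∈ A t i
    · by_cases h2 : 0 < M.mass t i x (y i)
      · simp [coordLik, h1, h2]
      · simp [h1, h2] at this
    · simp [coordLik, h1, hx i h1]
  · simp only [lik]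
    obtain ⟨i, hi, hlt⟩ := Finset.exists_lt_of_sum_lt
      (lt_of_le_of_ne (Finset.sum_le_sum hle) (Ne.symm h))
    refine Finset.prod_eq_zero hi ?_
    by_cases h1 : y i ∈ A t i
    · by_cases h2 : 0 < M.mass t i x (y i)
      · simp [h2] at hlt
      · simpa [coordLik, h1] using h2
    · simp only [h1, if_false] at hlt
      split_ifs at hlt <;> omega

/-- If some particle has positive likelihood, the kept weights are the likelihoods. -/
lemma keptWeight_eq_lik {t : ℕ} {y : Fin (m t) → ℝ} {K : ℕ} {x : Fin K → E t}
    (hx : ∀ k i, y i ∉ A t i → M.mass t i (x k) (y i) = 0)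
    (hpos : ∃ k, M.lik A t y (x k) ≠ 0) (k : Fin K) :
    M.keptWeight t y x k = M.lik A t y (x k) := by
  classical
  have H := fun k => M.lexWeight_of_mass_eq_zero (hx k)
  -- A particle of positive likelihood attains the lower bound on d with nonzero weight.
  have hd : M.dStar t y x = ∑ i, if y i ∈ A t i then 0 else 1 := by
    obtain ⟨k₀, hk₀⟩ := hpos
    obtain ⟨-, h2, h3⟩ := H k₀
    have h4 := not_imp_comm.1 h3 hk₀
    refine le_antisymm (Nat.sInf_le ⟨k₀, by rwa [h2 h4], h4⟩) ?_
    refine le_csInf ⟨_, ⟨k₀, by rwa [h2 h4], h4⟩⟩ ?_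
    rintro d ⟨j, -, rfl⟩
    exact (H j).1
  obtain ⟨h1, h2, h3⟩ := H k
  rw [keptWeight, hd]
  split_ifs with h
  · rw [h3 h.ne']
    simp
  · rw [h2 (le_antisymm (not_lt.1 h) h1)]

end MixedSSM

/-! ### Resampling and propagation -/

section PiKernel

variable {E F : Type*} [MeasurableSpace E] [MeasurableSpace F]

/-- Given a vector `x` of states, draw independently from the laws `κ (x (j k))`. -/
def piKernel (κ : Kernel E F) [IsMarkovKernel κ] {K : ℕ} (j : Fin K → Fin K) :
    Kernel (Fin K → E) (Fin K → F) where
  toFun x := Measure.pi fun k => κ (x (j k))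
  measurable' := by
    refine Measurable.measure_of_isPiSystem_of_isProbabilityMeasure generateFrom_pi.symm
      isPiSystem_pi ?_
    rintro s ⟨B, hB, rfl⟩
    simp_rw [Measure.pi_pi]
    exact Finset.measurable_fun_prod _ fun k _ =>
      (Kernel.measurable_coe κ (hB k trivial)).comp (measurable_pi_apply _)

lemma piKernel_apply (κ : Kernel E F) [IsMarkovKernel κ] {K : ℕ} (j : Fin K → Fin K)
    (x : Fin K → E) : piKernel κ j x = Measure.pi fun k => κ (x (j k)) := rfl

instance (κ : Kernel E F) [IsMarkovKernel κ] {K : ℕ} (j : Fin K → Fin K) :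
    IsMarkovKernel (piKernel κ j) :=
  ⟨fun x => by rw [piKernel_apply]; infer_instance⟩

/-- The normalized weight of the `j`-th particle. -/
def normWeight (w : E → ℝ≥0) {K : ℕ} (x : Fin K → E) (j : Fin K) : ℝ≥0∞ :=
  (w (x j) : ℝ≥0∞) / ∑ l, (w (x l) : ℝ≥0∞)

/-- The law of a new particle, given the weighted old particles. -/
def mixture (κ : Kernel E F) (w : E → ℝ≥0) {K : ℕ} (x : Fin K → E) : Measure F :=
  ∑ j, normWeight w x j • κ (x j)

variable {w : E → ℝ≥0} {K : ℕ} {x : Fin K → E}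

omit [MeasurableSpace E] in
lemma sum_normWeight (hx : ∃ k, w (x k) ≠ 0) : ∑ j, normWeight w x j = 1 := by
  simp_rw [normWeight, div_eq_mul_inv]
  rw [← Finset.sum_mul, ← div_eq_mul_inv]
  refine ENNReal.div_self ?_ (by simp)
  obtain ⟨k, hk⟩ := hx
  simp only [ne_eq, Finset.sum_eq_zero_iff, Finset.mem_univ, true_implies, not_forall]
  exact ⟨k, by simpa using hk⟩

lemma isProbabilityMeasure_mixture (κ : Kernel E F) [IsMarkovKernel κ]
    (hx : ∃ k, w (x k) ≠ 0) : IsProbabilityMeasure (mixture κ w x) := by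
  constructor
  simp only [mixture, Measure.finsetSum_apply, Measure.smul_apply, measure_univ, smul_eq_mul,
    mul_one]
  exact sum_normWeight hx

/-- Averaging over independent index choices makes the new particles i.i.d. from the mixture: on a
box, expand the product of sums over all index vectors. -/
lemma sum_smul_piKernel (κ : Kernel E F) [IsMarkovKernel κ] (hx : ∃ k, w (x k) ≠ 0) :
    ∑ j : Fin K → Fin K, (∏ k, normWeight w x (j k)) • piKernel κ j x
      = Measure.pi fun _ => mixture κ w x := by
  classical
  have := isProbabilityMeasure_mixture κ hx
  symm
  refine Measure.pi_eq fun B hB => ?_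
  simp only [mixture, Measure.finsetSum_apply, Measure.smul_apply, smul_eq_mul, piKernel_apply,
    Measure.pi_pi]
  rw [Finset.prod_univ_sum, Fintype.piFinset_univ]
  simp_rw [Finset.prod_mul_distrib]

end PiKernel

namespace MixedSSM

variable {E : ℕ → Type*} [∀ t, MeasurableSpace (E t)] {m : ℕ → ℕ} {M : MixedSSM E m}

namespace IsRun

variable {T : ℕ} {y : ∀ t, Fin (m t) → ℝ} {K : ℕ} {Ω' : Type*} [MeasurableSpace Ω']
  {ν : Measure Ω'} [IsProbabilityMeasure ν] {ξ : ∀ t, Ω' → Fin K → E t}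
  {α : ℕ → Ω' → Fin K → Fin K}

/-- Fixing the value of the index vector turns the propagation law into a kernel in the current
particles alone. -/
lemma lintegral_propagate (h : M.IsRun T y K ν ξ α) {t : ℕ} (ht : t < T) (j : Fin K → Fin K)
    {Φ : (Fin K → E t) × (Fin K → E (t + 1)) → ℝ≥0∞} (hΦ : Measurable Φ) :
    ∫⁻ ω in α t ⁻¹' {j}, Φ (ξ t ω, ξ (t + 1) ω) ∂ν
      = ∫⁻ ω in α t ⁻¹' {j}, ∫⁻ z, Φ (ξ t ω, z) ∂(piKernel (M.trans t) j (ξ t ω)) ∂ν := by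
  have hξ := h.measurable_particle t ht.le
  have hξ' := h.measurable_particle (t + 1) ht
  have hα := h.measurable_index t ht
  have hj : MeasurableSet (α t ⁻¹' {j}) := hα (measurableSet_singleton j)
  have hle : (⨆ s, ⨆ (_ : s ≤ t), MeasurableSpace.comap (ξ s) inferInstance ⊔
      MeasurableSpace.comap (α s) inferInstance) ≤ ‹MeasurableSpace Ω'› :=
    iSup_le fun s => iSup_le fun hs => sup_le (h.measurable_particle s (by omega)).comap_le
      (h.measurable_index s (by omega)).comap_le
  set μj := ν.restrict (α t ⁻¹' {j}) with hμj
  have key : μj.map (fun ω => (ξ t ω, ξ (t + 1) ω)) = (μj.map (ξ t)) ⊗ₘ piKernel (M.trans t) j := by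
    refine Measure.ext_prod fun {B C} hB hC => ?_
    have hU : Measurable[⨆ s, ⨆ (_ : s ≤ t), MeasurableSpace.comap (ξ s) inferInstance ⊔
        MeasurableSpace.comap (α s) inferInstance]
        ((ξ t ⁻¹' B ∩ α t ⁻¹' {j}).indicator fun _ => (1 : ℝ≥0∞)) := by
      refine measurable_const.indicator (MeasurableSet.inter ?_ ?_)
      · have : MeasurableSpace.comap (ξ t) inferInstance ≤
            ⨆ s, ⨆ (_ : s ≤ t), MeasurableSpace.comap (ξ s) inferInstance ⊔
              MeasurableSpace.comap (α s) inferInstance :=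
          le_iSup_of_le t (le_iSup_of_le le_rfl le_sup_left)
        exact this _ ⟨B, hB, rfl⟩
      · have : MeasurableSpace.comap (α t) inferInstance ≤
            ⨆ s, ⨆ (_ : s ≤ t), MeasurableSpace.comap (ξ s) inferInstance ⊔
              MeasurableSpace.comap (α s) inferInstance :=
          le_iSup_of_le t (le_iSup_of_le le_rfl le_sup_right)
        exact this _ ⟨{j}, measurableSet_singleton j, rfl⟩
    have h1 := lintegral_mul_indicator_eq_condExp (P := ν) hle (hξ' hC) hU
    rw [Measure.compProd_apply_prod hB hC, Measure.map_apply (hξ.prodMk hξ') (hB.prod hC),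
      setLIntegral_map hB (Kernel.measurable_coe _ hC) hξ, hμj,
      Measure.restrict_apply ((hξ.prodMk hξ') (hB.prod hC)), Measure.restrict_restrict (hξ hB),
      ← lintegral_indicator_one (((hξ.prodMk hξ') (hB.prod hC)).inter hj),
      ← lintegral_indicator ((hξ hB).inter hj)]
    calc _ = _ := lintegral_congr fun ω => ?_
      _ = _ := h1
      _ = _ := lintegral_congr_ae ?_
    · by_cases h1 : ξ t ω ∈ B <;> by_cases h2 : ξ (t + 1) ω ∈ C <;>
        by_cases h3 : α t ω = j <;> simp [h1, h2, h3]
    · filter_upwards [h.propagate t ht C hC] with ω hω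
      rw [hω, ofReal_measureReal]
      by_cases h1 : ω ∈ ξ t ⁻¹' B ∩ α t ⁻¹' {j}
      · rw [Set.indicator_of_mem h1, Set.indicator_of_mem h1, one_mul, piKernel_apply]
        have : α t ω = j := h1.2
        rw [this]
      · rw [Set.indicator_of_notMem h1, Set.indicator_of_notMem h1, zero_mul]
  have hm : Measurable fun x => ∫⁻ z, Φ (x, z) ∂(piKernel (M.trans t) j x) :=
    Measurable.lintegral_kernel_prod_right (f := fun x z => Φ (x, z)) hΦ
  rw [← lintegral_map (f := Φ) hΦ (hξ.prodMk hξ'), key, Measure.lintegral_compProd hΦ,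
    lintegral_map hm hξ]

/-- One step of the filter at particle configurations whose kept weights are given by `w`. -/
lemma lintegral_step (h : M.IsRun T y K ν ξ α) {t : ℕ} (ht : t < T) {w : E t → ℝ≥0}
    (hwm : Measurable w)
    (hw : ∀ᵐ ω ∂ν, (∃ k, w (ξ t ω k) ≠ 0) → ∀ k, M.keptWeight t (y t) (ξ t ω) k = w (ξ t ω k))
    {Φ : (Fin K → E t) × (Fin K → E (t + 1)) → ℝ≥0∞} (hΦ : Measurable Φ)
    (hΦ0 : ∀ x z, (∀ k, w (x k) = 0) → Φ (x, z) = 0) :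
    ∫⁻ ω, Φ (ξ t ω, ξ (t + 1) ω) ∂ν
      = ∫⁻ ω, ∫⁻ z, Φ (ξ t ω, z) ∂(Measure.pi fun _ => mixture (M.trans t) w (ξ t ω)) ∂ν := by
  classical
  have hξ := h.measurable_particle t ht.le
  have hα := h.measurable_index t ht
  have hj : ∀ j, MeasurableSet (α t ⁻¹' {j}) := fun j => hα (measurableSet_singleton j)
  have hle : (⨆ s, ⨆ (_ : s ≤ t), MeasurableSpace.comap (ξ s) inferInstance) ⊔
      (⨆ s, ⨆ (_ : s < t), MeasurableSpace.comap (α s) inferInstance) ≤ ‹MeasurableSpace Ω'› :=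
    sup_le (iSup_le fun s => iSup_le fun hs => (h.measurable_particle s (by omega)).comap_le)
      (iSup_le fun s => iSup_le fun hs => (h.measurable_index s (by omega)).comap_le)
  have hξp : MeasurableSpace.comap (ξ t) inferInstance ≤
      (⨆ s, ⨆ (_ : s ≤ t), MeasurableSpace.comap (ξ s) inferInstance) ⊔
      (⨆ s, ⨆ (_ : s < t), MeasurableSpace.comap (α s) inferInstance) :=
    le_sup_of_le_left (le_iSup₂_of_le t le_rfl le_rfl)
  have hm : ∀ j, Measurable fun x => ∫⁻ z, Φ (x, z) ∂(piKernel (M.trans t) j x) := fun j =>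
    Measurable.lintegral_kernel_prod_right (f := fun x z => Φ (x, z)) hΦ
  have hm0 : ∀ j x, (∀ k, w (x k) = 0) → ∫⁻ z, Φ (x, z) ∂(piKernel (M.trans t) j x) = 0 := by
    intro j x hx
    simp [hΦ0 x _ hx]
  have hsplit : ∫⁻ ω, Φ (ξ t ω, ξ (t + 1) ω) ∂ν
      = ∑ j : Fin K → Fin K, ∫⁻ ω in α t ⁻¹' {j}, Φ (ξ t ω, ξ (t + 1) ω) ∂ν := by
    simp_rw [← lintegral_indicator (hj _)]
    have hF : Measurable fun ω => Φ (ξ t ω, ξ (t + 1) ω) :=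
      hΦ.comp (hξ.prodMk (h.measurable_particle (t + 1) ht))
    rw [← lintegral_finsetSum _ fun j _ => hF.indicator (hj j)]
    refine lintegral_congr fun ω => ?_
    rw [Finset.sum_eq_single (α t ω)]
    · simp
    · intro j _ hne
      exact Set.indicator_of_notMem (fun h => hne h.symm) _
    · simp
  have hterm : ∀ j : Fin K → Fin K, ∫⁻ ω in α t ⁻¹' {j}, Φ (ξ t ω, ξ (t + 1) ω) ∂ν
      = ∫⁻ ω, (∏ k, normWeight w (ξ t ω) (j k)) *
          ∫⁻ z, Φ (ξ t ω, z) ∂(piKernel (M.trans t) j (ξ t ω)) ∂ν := by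
    intro j
    have hU := (hm j).comp ((comap_measurable (ξ t)).mono hξp le_rfl)
    rw [h.lintegral_propagate ht j hΦ, ← lintegral_indicator (hj j)]
    calc _ = _ := lintegral_congr fun ω => ?_
      _ = _ := lintegral_mul_indicator_eq_condExp (P := ν) hle (hj j) hU
      _ = _ := lintegral_congr_ae ?_
    · by_cases h1 : α t ω = j <;> simp [h1]
    · filter_upwards [hw, h.resample t ht j] with ω hω1 hω2
      simp only [Function.comp_apply]
      by_cases hex : ∃ k, w (ξ t ω k) ≠ 0
      · have hk := hω1 hex
        simp only [hk] at hω2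
        have hpos : (0 : ℝ) < ∑ l, (w (ξ t ω l) : ℝ) := by
          obtain ⟨k, hk⟩ := hex
          refine Finset.sum_pos' (fun l _ => NNReal.coe_nonneg _) ⟨k, Finset.mem_univ k, ?_⟩
          exact_mod_cast pos_iff_ne_zero.2 hk
        rw [hω2 hpos.ne', mul_comm]
        congr 1
        rw [ENNReal.ofReal_prod_of_nonneg fun k _ => by positivity]
        refine Finset.prod_congr rfl fun k _ => ?_
        rw [ENNReal.ofReal_div_of_pos hpos, normWeight,
          ENNReal.ofReal_sum_of_nonneg fun l _ => NNReal.coe_nonneg _]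
        simp
      -- If all likelihoods vanish, the kept weights need not equal `w`, and the resampling law is
      -- unknown; Φ is zero there.
      · push Not at hex
        rw [hm0 j _ hex, zero_mul, mul_zero]
  have hnw : ∀ k, Measurable fun x : Fin K → E t => normWeight w x k := fun k =>
    ((hwm.comp (measurable_pi_apply k)).coe_nnreal_ennreal).div
      (Finset.measurable_fun_sum _ fun l _ => (hwm.comp (measurable_pi_apply l)).coe_nnreal_ennreal)
  have hF : ∀ j : Fin K → Fin K, Measurable fun ω => (∏ k, normWeight w (ξ t ω) (j k)) *
      ∫⁻ z, Φ (ξ t ω, z) ∂(piKernel (M.trans t) j (ξ t ω)) := fun j =>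
    (Finset.measurable_fun_prod _ fun k _ => (hnw (j k)).comp hξ).mul ((hm j).comp hξ)
  rw [hsplit, Finset.sum_congr rfl fun j _ => hterm j, ← lintegral_finsetSum _ fun j _ => hF j]
  refine lintegral_congr fun ω => ?_
  by_cases hex : ∃ k, w (ξ t ω k) ≠ 0
  · rw [← sum_smul_piKernel (M.trans t) hex, lintegral_finsetSum_measure]
    simp_rw [lintegral_smul_measure, smul_eq_mul]
  · push Not at hex
    simp [hΦ0 _ _ hex]

end IsRun

end MixedSSM

/-! ### Integrals against the mixture -/

section Mixture

variable {E F : Type*} [MeasurableSpace E] [MeasurableSpace F] {κ : Kernel E F}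
  {w : E → ℝ≥0} {K : ℕ} {x : Fin K → E}

omit [MeasurableSpace E] in
lemma toReal_normWeight (j : Fin K) :
    (normWeight w x j).toReal = w (x j) / ∑ l, (w (x l) : ℝ) := by
  rw [normWeight, ENNReal.toReal_div, ENNReal.toReal_sum fun _ _ => ENNReal.coe_ne_top]
  simp

lemma lintegral_mixture_le {φ : F → ℝ≥0∞} {R : ℝ≥0}
    (hR : ∑ k, w (x k) * ∫⁻ z, φ z ∂(κ (x k)) ≤ R * ∑ k, (w (x k) : ℝ≥0∞)) :
    ∫⁻ z, φ z ∂(mixture κ w x) ≤ R := by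
  rw [mixture, lintegral_finsetSum_measure]
  simp_rw [lintegral_smul_measure, smul_eq_mul, normWeight, ENNReal.mul_div_right_comm.symm,
    div_eq_mul_inv]
  rw [← Finset.sum_mul, ← div_eq_mul_inv]
  exact ENNReal.div_le_of_le_mul hR

lemma integral_mixture {φ : F → ℝ} (hφ : ∀ k, w (x k) ≠ 0 → Integrable φ (κ (x k))) :
    ∫ z, φ z ∂(mixture κ w x)
      = (∑ k, w (x k) * ∫ z, φ z ∂(κ (x k))) / ∑ k, (w (x k) : ℝ) := by
  have hne : ∀ k, normWeight w x k ≠ ∞ := by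
    intro k
    by_cases h : w (x k) = 0
    · simp [normWeight, h]
    · refine (ENNReal.div_lt_top ENNReal.coe_ne_top ?_).ne
      simp only [ne_eq, Finset.sum_eq_zero_iff, Finset.mem_univ, true_implies, not_forall]
      exact ⟨k, by simpa using h⟩
  rw [mixture, integral_finsetSum_measure]
  · simp_rw [integral_smul_measure, toReal_normWeight, smul_eq_mul]
    rw [Finset.sum_div]
    exact Finset.sum_congr rfl fun k _ => by ring
  · intro k _
    by_cases h : w (x k) = 0
    · simp [normWeight, h]
    · exact (hφ k h).smul_measure (hne k)

end Mixture

/-! ### One-step error bounds -/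

namespace MixedSSM

variable {E : ℕ → Type*} [∀ t, MeasurableSpace (E t)] {m : ℕ → ℕ} {M : MixedSSM E m}

namespace IsRun

variable {T : ℕ} {y : ∀ t, Fin (m t) → ℝ} {K : ℕ} {Ω' : Type*} [MeasurableSpace Ω']
  {ν : Measure Ω'} [IsProbabilityMeasure ν] {ξ : ∀ t, Ω' → Fin K → E t}
  {α : ℕ → Ω' → Fin K → Fin K}

/-- The law of every particle is absolutely continuous with respect to the law of the state. -/
lemma ae_particle (h : M.IsRun T y K ν ξ α) {lam : ∀ t, Measure (E t)} (h0 : lam 0 = M.init)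
    (hsucc : ∀ t < T, lam (t + 1) = (lam t).bind (M.trans t)) {t : ℕ} (ht : t ≤ T)
    {p : E t → Prop} (hp : ∀ᵐ x ∂(lam t), p x) : ∀ᵐ ω ∂ν, ∀ k, p (ξ t ω k) := by
  induction t with
  | zero =>
    rw [h0] at hp
    refine ae_all_iff.2 fun k => ?_
    have h1 : ∀ᵐ x : Fin K → E 0 ∂(Measure.pi fun _ => M.init), p (x k) :=
      Measure.tendsto_eval_ae_ae.eventually hp
    rw [← h.init] at h1
    exact ae_of_ae_map (h.measurable_particle 0 ht).aemeasurable h1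
  | succ t ih =>
    rw [hsucc t ht] at hp
    obtain ⟨N, hpN, hN, hN0⟩ := exists_measurable_superset_of_null (ae_iff.1 hp)
    rw [Measure.bind_apply hN (M.trans t).aemeasurable,
      lintegral_eq_zero_iff (Kernel.measurable_coe _ hN)] at hN0
    -- The kernel gives N mass zero from almost every state, so all current particles may be assumed
    -- to be such states. Whichever indices are selected, propagation then misses N; the resampling
    -- law plays no role.
    have hξ := ih (by omega) hN0
    refine ae_all_iff.2 fun k => ?_
    set B : Set (Fin K → E (t + 1)) := Function.eval k ⁻¹' N
    have hB : MeasurableSet B := measurable_pi_apply k hN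
    have hle : (⨆ s, ⨆ (_ : s ≤ t), MeasurableSpace.comap (ξ s) inferInstance ⊔
        MeasurableSpace.comap (α s) inferInstance) ≤ ‹MeasurableSpace Ω'› :=
      iSup_le fun s => iSup_le fun hs => sup_le (h.measurable_particle s (by omega)).comap_le
        (h.measurable_index s (by omega)).comap_le
    have hBm := h.measurable_particle (t + 1) ht hB
    have key := lintegral_mul_indicator_eq_condExp (P := ν) hle hBm (U := fun _ => 1)
      measurable_const
    simp_rw [one_mul] at key
    rw [lintegral_indicator_one hBm] at key
    have hzero : ν (ξ (t + 1) ⁻¹' B) = 0 := by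
      rw [key]
      refine lintegral_eq_zero_of_ae_eq_zero ?_
      filter_upwards [h.propagate t ht B hB, hξ] with ω h1 h2
      rw [h1, ofReal_measureReal]
      have := (measurePreserving_eval (fun k => M.trans t (ξ t ω (α t ω k))) k).measure_preimage
        hN.nullMeasurableSet
      rw [this]
      exact h2 _
    filter_upwards [measure_eq_zero_iff_ae_notMem.1 hzero] with ω hω
    by_contra hc
    exact hω (hpN hc)

omit [IsProbabilityMeasure ν] in
lemma measure_initial_error_le (h : M.IsRun T y K ν ξ α) (hK : 0 < K) {φ : E 0 → ℝ}
    (hφ : Measurable φ) {R : ℝ≥0} (hR : ∫⁻ x, ‖φ x‖ₑ ^ 4 ∂M.init ≤ R) {ε : ℝ≥0} (hε : 0 < ε) :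
    ν {ω | (ε : ℝ≥0∞) ≤ ‖(∑ k, φ (ξ 0 ω k)) / K - ∫ x, φ x ∂M.init‖ₑ}
      ≤ ENNReal.ofReal (48 * R / K ^ 2) / ε ^ 4 := by
  have hξ := h.measurable_particle 0 (by omega)
  have hm : Measurable fun z : Fin K → E 0 => ‖(∑ k, φ (z k)) / K - ∫ x, φ x ∂M.init‖ₑ ^ 4 := by
    fun_prop
  have h1 := lintegral_empirical_error_le hφ hR hK
  rw [← h.init, lintegral_map hm hξ] at h1
  refine le_trans ?_ (ENNReal.div_le_div_right h1 _)
  refine le_trans (measure_mono fun ω hω => ?_) (meas_ge_le_lintegral_div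
    (hm.comp hξ).aemeasurable (by simp [hε.ne']) (by simp))
  have hω' : (ε : ℝ≥0∞) ≤ ‖(∑ k, φ (ξ 0 ω k)) / K - ∫ x, φ x ∂M.init‖ₑ := hω
  exact pow_le_pow_left' hω' 4

/-- Markov's inequality for the fourth power, conditionally on the particles at time t. The
mixture's fourth moment is random and has no uniform bound, so the bound R is made part of the
event. -/
lemma measure_step_error_le (h : M.IsRun T y K ν ξ α) (hK : 0 < K) {t : ℕ} (ht : t < T)
    {w : E t → ℝ≥0} (hwm : Measurable w)
    (hw : ∀ᵐ ω ∂ν, (∃ k, w (ξ t ω k) ≠ 0) → ∀ k, M.keptWeight t (y t) (ξ t ω) k = w (ξ t ω k))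
    {φ : E (t + 1) → ℝ} (hφ : Measurable φ) (R : ℝ≥0) {ε : ℝ≥0} (hε : 0 < ε) :
    ν {ω | ((∃ k, w (ξ t ω k) ≠ 0) ∧
        ∑ k, w (ξ t ω k) * ∫⁻ z, ‖φ z‖ₑ ^ 4 ∂(M.trans t (ξ t ω k))
          ≤ R * ∑ k, (w (ξ t ω k) : ℝ≥0∞)) ∧
        (ε : ℝ≥0∞) ≤ ‖(∑ k, φ (ξ (t + 1) ω k)) / K -
          (∑ k, w (ξ t ω k) * ∫ z, φ z ∂(M.trans t (ξ t ω k))) / ∑ k, (w (ξ t ω k) : ℝ)‖ₑ}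
      ≤ ENNReal.ofReal (48 * R / K ^ 2) / ε ^ 4 := by
  classical
  have hξ := h.measurable_particle t ht.le
  have hξ' := h.measurable_particle (t + 1) ht
  set G : Set (Fin K → E t) := {x | (∃ k, w (x k) ≠ 0) ∧
    ∑ k, w (x k) * ∫⁻ z, ‖φ z‖ₑ ^ 4 ∂(M.trans t (x k)) ≤ R * ∑ k, (w (x k) : ℝ≥0∞)} with hG
  have hq : Measurable fun x => ∫⁻ z, ‖φ z‖ₑ ^ 4 ∂(M.trans t x) :=
    Measurable.lintegral_kernel (by fun_prop)
  have hψ : Measurable fun x => ∫ z, φ z ∂(M.trans t x) :=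
    (hφ.stronglyMeasurable.integral_kernel).measurable
  have hGm : MeasurableSet G := by
    have h2 : Measurable fun x : Fin K → E t =>
        ∑ k, w (x k) * ∫⁻ z, ‖φ z‖ₑ ^ 4 ∂(M.trans t (x k)) :=
      Finset.measurable_fun_sum _ fun k _ =>
        (hwm.coe_nnreal_ennreal.mul hq).comp (measurable_pi_apply k)
    have h3 : Measurable fun x : Fin K → E t => R * ∑ k, (w (x k) : ℝ≥0∞) :=
      (Finset.measurable_fun_sum _ fun k _ =>
        hwm.coe_nnreal_ennreal.comp (measurable_pi_apply k)).const_mul _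
    have : {x : Fin K → E t | ∃ k, w (x k) ≠ 0} = ⋃ k, {x | w (x k) ≠ 0} := by
      ext x; simp
    have hpos : MeasurableSet {x : Fin K → E t | ∃ k, w (x k) ≠ 0} := by
      rw [this]
      exact MeasurableSet.iUnion fun k =>
        (measurableSet_eq_fun (hwm.comp (measurable_pi_apply k)) measurable_const).compl
    exact hpos.inter (measurableSet_le h2 h3)
  set D : (Fin K → E t) × (Fin K → E (t + 1)) → ℝ≥0∞ := fun p =>
    ‖(∑ k, φ (p.2 k)) / K -
      (∑ k, w (p.1 k) * ∫ z, φ z ∂(M.trans t (p.1 k))) / ∑ k, (w (p.1 k) : ℝ)‖ₑ ^ 4 with hD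
  have hDm : Measurable D := by
    have h1 : ∀ k, Measurable fun p : (Fin K → E t) × (Fin K → E (t + 1)) => φ (p.2 k) :=
      fun k => hφ.comp ((measurable_pi_apply k).comp measurable_snd)
    have h2 : ∀ k, Measurable fun p : (Fin K → E t) × (Fin K → E (t + 1)) => (w (p.1 k) : ℝ) :=
      fun k => (hwm.comp ((measurable_pi_apply k).comp measurable_fst)).coe_nnreal_real
    have h3 : ∀ k, Measurable fun p : (Fin K → E t) × (Fin K → E (t + 1)) =>
        ∫ z, φ z ∂(M.trans t (p.1 k)) :=
      fun k => hψ.comp ((measurable_pi_apply k).comp measurable_fst)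
    exact ((((Finset.measurable_fun_sum _ fun k _ => h1 k).div_const _).sub
      ((Finset.measurable_fun_sum _ fun k _ => (h2 k).mul (h3 k)).div
        (Finset.measurable_fun_sum _ fun k _ => h2 k))).enorm).pow_const 4
  set Φ : (Fin K → E t) × (Fin K → E (t + 1)) → ℝ≥0∞ := (G ×ˢ Set.univ).indicator D with hΦ
  have hΦm : Measurable Φ := hDm.indicator (hGm.prod MeasurableSet.univ)
  have hΦ0 : ∀ x z, (∀ k, w (x k) = 0) → Φ (x, z) = 0 := by
    intro x z hx
    refine Set.indicator_of_notMem ?_ _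
    rintro ⟨⟨⟨k, hk⟩, -⟩, -⟩
    exact hk (hx k)
  have hbound : ∫⁻ ω, Φ (ξ t ω, ξ (t + 1) ω) ∂ν ≤ ENNReal.ofReal (48 * R / K ^ 2) := by
    rw [h.lintegral_step ht hwm hw hΦm hΦ0]
    calc _ ≤ ∫⁻ _, ENNReal.ofReal (48 * R / K ^ 2) ∂ν := lintegral_mono fun ω => ?_
      _ = _ := by simp
    by_cases hx : ξ t ω ∈ G
    swap
    · simp [hΦ, hx]
    obtain ⟨hpos, hR⟩ := hx
    have := isProbabilityMeasure_mixture (M.trans t) hpos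
    -- The weighted sum bounded by R forces a finite fourth moment at every particle of positive
    -- weight.
    have hint : ∀ k, w (ξ t ω k) ≠ 0 → Integrable φ (M.trans t (ξ t ω k)) := by
      intro k hk
      have hfin : ∫⁻ z, ‖φ z‖ₑ ^ 4 ∂(M.trans t (ξ t ω k)) ≠ ∞ := by
        intro htop
        have h1 : (w (ξ t ω k) : ℝ≥0∞) * ∫⁻ z, ‖φ z‖ₑ ^ 4 ∂(M.trans t (ξ t ω k)) = ∞ := by
          rw [htop]; exact ENNReal.mul_top (by simpa using hk)
        have h2 := (Finset.single_le_sum (fun j _ => zero_le) (Finset.mem_univ k)).trans hR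
        rw [h1, top_le_iff] at h2
        exact (ENNReal.mul_ne_top ENNReal.coe_ne_top (by simp)) h2
      have hmem : MemLp φ (4 : ℕ) (M.trans t (ξ t ω k)) := by
        refine ⟨hφ.aestronglyMeasurable, ?_⟩
        rw [eLpNorm_lt_top_iff_lintegral_rpow_enorm_lt_top (by norm_num) (by simp)]
        refine lt_of_eq_of_lt (lintegral_congr fun x => ?_) (lt_top_iff_ne_top.2 hfin)
        rw [ENNReal.toReal_natCast, ENNReal.rpow_natCast]
      exact hmem.integrable (by norm_num)
    have h1 := lintegral_empirical_error_le (μ := mixture (M.trans t) w (ξ t ω)) hφ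
      (lintegral_mixture_le hR) hK
    rw [integral_mixture hint] at h1
    refine le_trans (le_of_eq (lintegral_congr fun z => ?_)) h1
    rw [hΦ, Set.indicator_of_mem (show (ξ t ω, z) ∈ G ×ˢ Set.univ from ⟨⟨hpos, hR⟩, trivial⟩)]
  refine le_trans ?_ (ENNReal.div_le_div_right hbound _)
  refine le_trans (measure_mono fun ω hω => ?_) (meas_ge_le_lintegral_div
    (hΦm.comp (hξ.prodMk hξ')).aemeasurable (by simp [hε.ne']) (by simp))
  have : Φ (ξ t ω, ξ (t + 1) ω) = D (ξ t ω, ξ (t + 1) ω) :=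
    Set.indicator_of_mem (show (ξ t ω, ξ (t + 1) ω) ∈ G ×ˢ Set.univ from ⟨hω.1, trivial⟩) _
  change (ε : ℝ≥0∞) ^ 4 ≤ Φ (ξ t ω, ξ (t + 1) ω)
  rw [this]
  exact pow_le_pow_left' hω.2 4

end IsRun

end MixedSSM

/-! ### Functions with all moments -/

section AllMoments

variable {E F : Type*} [MeasurableSpace E] [MeasurableSpace F]

/-- All moments of `φ` under `μ` are finite. -/
def AllMoments (φ : E → ℝ) (μ : Measure E) : Prop := ∀ p : ℕ, MemLp φ p μ

lemma memLp_natCast_iff {φ : E → ℝ} (hφ : Measurable φ) {μ : Measure E} {p : ℕ} (hp : p ≠ 0) :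
    MemLp φ p μ ↔ ∫⁻ x, ‖φ x‖ₑ ^ p ∂μ < ∞ := by
  rw [MemLp, eLpNorm_lt_top_iff_lintegral_rpow_enorm_lt_top (by exact_mod_cast hp) (by simp)]
  simp only [ENNReal.toReal_natCast, ENNReal.rpow_natCast]
  exact and_iff_right hφ.aestronglyMeasurable

/-- Hölder with exponents 2p, 2p. A class with one fixed exponent would not be closed under
products. -/
lemma AllMoments.mul {φ ψ : E → ℝ} {μ : Measure E} (hφ : AllMoments φ μ) (hψ : AllMoments ψ μ) :
    AllMoments (fun x => φ x * ψ x) μ := by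
  intro p
  have : ENNReal.HolderTriple ((2 * p : ℕ) : ℝ≥0∞) ((2 * p : ℕ) : ℝ≥0∞) p := by
    constructor
    push_cast
    rw [ENNReal.mul_inv (by simp) (by simp), ← add_mul, ENNReal.inv_two_add_inv_two, one_mul]
  exact MemLp.mul' (hψ (2 * p)) (hφ (2 * p))

lemma AllMoments.finset_prod {ι : Type*} {φ : ι → E → ℝ} {μ : Measure E} [IsFiniteMeasure μ]
    (s : Finset ι) (h : ∀ i ∈ s, AllMoments (φ i) μ) :
    AllMoments (fun x => ∏ i ∈ s, φ i x) μ := by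
  classical
  induction s using Finset.induction_on with
  | empty =>
    intro p
    simpa using memLp_const (1 : ℝ)
  | insert a s ha ih =>
    simp only [Finset.prod_insert ha]
    exact (h a (Finset.mem_insert_self a s)).mul
      (ih fun i hi => h i (Finset.mem_insert_of_mem hi))

lemma AllMoments.abs {φ : E → ℝ} {μ : Measure E} (hφ : AllMoments φ μ) :
    AllMoments (fun x => |φ x|) μ := fun p => (hφ p).norm

lemma AllMoments.integrable {φ : E → ℝ} {μ : Measure E} (hφ : AllMoments φ μ) :
    Integrable φ μ := by
  have := hφ 1
  rwa [Nat.cast_one, memLp_one_iff_integrable] at this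

/-- Jensen's inequality for the kernel mean. -/
lemma enorm_integral_pow_le {μ : Measure E} [IsProbabilityMeasure μ] {φ : E → ℝ}
    (hφ : Measurable φ) {p : ℕ} (hp : p ≠ 0) :
    ‖∫ x, φ x ∂μ‖ₑ ^ p ≤ ∫⁻ x, ‖φ x‖ₑ ^ p ∂μ := by
  have hp1 : (1 : ℝ≥0∞) ≤ p := by exact_mod_cast Nat.one_le_iff_ne_zero.2 hp
  have h1 : ‖∫ x, φ x ∂μ‖ₑ ≤ eLpNorm φ p μ := by
    refine (enorm_integral_le_lintegral_enorm φ).trans ?_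
    rw [← eLpNorm_one_eq_lintegral_enorm]
    exact eLpNorm_le_eLpNorm_of_exponent_le hp1 hφ.aestronglyMeasurable
  refine (pow_le_pow_left' h1 p).trans (le_of_eq ?_)
  rw [eLpNorm_eq_lintegral_rpow_enorm_toReal (by exact_mod_cast hp) (by simp)]
  simp only [ENNReal.toReal_natCast, ENNReal.rpow_natCast]
  rw [← ENNReal.rpow_natCast, ← ENNReal.rpow_mul, one_div,
    inv_mul_cancel₀ (by exact_mod_cast hp), ENNReal.rpow_one]

lemma measurable_integral_kernel (κ : Kernel E F) {φ : F → ℝ} (hφ : Measurable φ) :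
    Measurable fun x => ∫ z, φ z ∂(κ x) :=
  hφ.stronglyMeasurable.integral_kernel.measurable

lemma AllMoments.integral_kernel {μ : Measure E} {κ : Kernel E F} [IsMarkovKernel κ] {φ : F → ℝ}
    (hφm : Measurable φ) (hφ : AllMoments φ (μ.bind κ)) :
    AllMoments (fun x => ∫ z, φ z ∂(κ x)) μ := by
  intro p
  by_cases hp : p = 0
  · subst hp
    simpa using (measurable_integral_kernel κ hφm).aestronglyMeasurable
  rw [memLp_natCast_iff (measurable_integral_kernel κ hφm) hp]
  refine lt_of_le_of_lt (lintegral_mono fun x => enorm_integral_pow_le hφm hp) ?_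
  rw [← Measure.lintegral_bind κ.aemeasurable (by fun_prop)]
  exact (memLp_natCast_iff hφm hp).1 (hφ p)

lemma AllMoments.ae_lintegral_kernel_lt_top {μ : Measure E} {κ : Kernel E F} {φ : F → ℝ}
    (hφm : Measurable φ) (hφ : AllMoments φ (μ.bind κ)) {p : ℕ} (hp : p ≠ 0) :
    ∀ᵐ x ∂μ, ∫⁻ z, ‖φ z‖ₑ ^ p ∂(κ x) < ∞ := by
  refine ae_lt_top (Measurable.lintegral_kernel (by fun_prop)) ?_
  rw [← Measure.lintegral_bind κ.aemeasurable (by fun_prop)]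
  exact ((memLp_natCast_iff hφm hp).1 (hφ p)).ne

end AllMoments

/-! ### Almost sure convergence -/

section BorelCantelli

/-- Borel–Cantelli over K for each of countably many R and ε = 1/(n + 1); afterwards R is chosen
depending on ω. Only the law for each single K enters. -/
lemma tendsto_zero_of_measure_le {Ω : Type*} [MeasurableSpace Ω] {ν : Measure Ω}
    {D : ℕ → Ω → ℝ} {G : ℕ → ℕ → Ω → Prop}
    (hbound : ∀ (R : ℕ) (ε : ℝ≥0), 0 < ε → ∀ K, 0 < K →
      ν {ω | G K R ω ∧ (ε : ℝ≥0∞) ≤ ‖D K ω‖ₑ} ≤ ENNReal.ofReal (48 * R / K ^ 2) / ε ^ 4)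
    (hG : ∀ᵐ ω ∂ν, ∃ R, ∀ᶠ K in atTop, G K R ω) :
    ∀ᵐ ω ∂ν, Tendsto (fun K => D K ω) atTop (𝓝 0) := by
  have hev : ∀ R n : ℕ, ∀ᵐ ω ∂ν, ∀ᶠ K in atTop,
      ¬ (G K R ω ∧ (((n + 1 : ℝ≥0)⁻¹ : ℝ≥0) : ℝ≥0∞) ≤ ‖D K ω‖ₑ) := by
    intro R n
    set ε : ℝ≥0 := (n + 1 : ℝ≥0)⁻¹
    have hε : 0 < ε := by positivity
    have hsum : ∑' K : ℕ, ν {ω | G (K + 1) R ω ∧ (ε : ℝ≥0∞) ≤ ‖D (K + 1) ω‖ₑ} ≠ ∞ := by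
      refine ne_top_of_le_ne_top ?_ (ENNReal.tsum_le_tsum fun K => hbound R ε hε (K + 1) (by omega))
      simp_rw [div_eq_mul_inv (ENNReal.ofReal _)]
      rw [ENNReal.tsum_mul_right]
      refine ENNReal.mul_ne_top (Summable.tsum_ofReal_ne_top ?_) (by simp [hε.ne'])
      have : Summable fun K : ℕ => 1 / (K : ℝ) ^ 2 := Real.summable_one_div_nat_pow.2 (by norm_num)
      have := ((summable_nat_add_iff 1).2 this).mul_left (48 * (R : ℝ))
      refine this.congr fun K => by ring
    filter_upwards [ae_eventually_notMem hsum] with ω hω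
    rw [← map_add_atTop_eq_nat 1]
    exact eventually_map.2 hω
  filter_upwards [ae_all_iff.2 fun R => ae_all_iff.2 (hev R), hG] with ω h1 h2
  obtain ⟨R, hR⟩ := h2
  rw [Metric.tendsto_atTop']
  intro δ hδ
  obtain ⟨n, hn⟩ := exists_nat_one_div_lt hδ
  obtain ⟨N, hN⟩ := eventually_atTop.1 ((h1 R n).and hR)
  refine ⟨N, fun K hK => ?_⟩
  obtain ⟨h3, h4⟩ := hN K hK.le
  have h5 : ‖D K ω‖ₑ < (((n + 1 : ℝ≥0)⁻¹ : ℝ≥0) : ℝ≥0∞) := not_le.1 fun h => h3 ⟨h4, h⟩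
  rw [dist_zero_right]
  refine lt_trans ?_ hn
  rw [enorm_eq_nnnorm, ENNReal.coe_lt_coe, ← NNReal.coe_lt_coe] at h5
  simpa using h5

end BorelCantelli

/-! ### Integrability under the predictive laws -/

section PredictiveLaw

variable {E : ℕ → Type*} [∀ t, MeasurableSpace (E t)] {μ : Measure (E 0)}
  {κ : ∀ t, Kernel (E t) (E (t + 1))} [∀ t, IsMarkovKernel (κ t)] {g : ∀ t, E t → ℝ≥0} {T : ℕ}
  {lam : ∀ t, Measure (E t)}

omit [∀ t, IsMarkovKernel (κ t)] in
lemma predLaw_absolutelyContinuous (h0 : lam 0 = μ)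
    (hsucc : ∀ t < T, lam (t + 1) = (lam t).bind (κ t)) {t : ℕ} (ht : t ≤ T) :
    predLaw μ κ g t ≪ lam t := by
  induction t with
  | zero => rw [h0]; exact Measure.AbsolutelyContinuous.rfl
  | succ t ih =>
    refine Measure.AbsolutelyContinuous.mk fun N hN hN0 => ?_
    rw [hsucc t ht, Measure.bind_apply hN (κ t).aemeasurable,
      lintegral_eq_zero_iff (Kernel.measurable_coe _ hN)] at hN0
    rw [predLaw, Measure.bind_apply hN (κ t).aemeasurable,
      lintegral_eq_zero_iff (Kernel.measurable_coe _ hN)]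
    exact ((posterior_absolutelyContinuous _ _).trans (ih (by omega))).ae_eq hN0

/-- Absolute continuity with respect to `lam t` does not transfer moments. Instead, integrability of
φ at time t + 1 reduces to that of g_t times the kernel mean of |φ| at time t, which again has all
moments under `lam t`. -/
lemma integrable_predLaw (hg : ∀ t, Measurable (g t)) (h0 : lam 0 = μ)
    (hsucc : ∀ t < T, lam (t + 1) = (lam t).bind (κ t))
    (hgm : ∀ t ≤ T, AllMoments (fun x => (g t x : ℝ)) (lam t))
    (hZ : ∀ t ≤ T, ∫⁻ x, g t x ∂(predLaw μ κ g t) ≠ 0) {t : ℕ} (ht : t ≤ T) {φ : E t → ℝ}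
    (hφm : Measurable φ) (hφ : AllMoments φ (lam t)) : Integrable φ (predLaw μ κ g t) := by
  induction t with
  | zero => rw [h0] at hφ; exact hφ.integrable
  | succ t ih =>
    rw [hsucc t ht] at hφ
    have hq := hφ.ae_lintegral_kernel_lt_top hφm one_ne_zero
    have hψ := (AllMoments.integral_kernel hφm.abs hφ.abs)
    have hψm := measurable_integral_kernel (κ t) hφm.abs
    have hint := ih (by omega) ((hg t).coe_nnreal_real.mul hψm) ((hgm t (by omega)).mul hψ)
    refine ⟨hφm.aestronglyMeasurable, ?_⟩
    rw [hasFiniteIntegral_iff_enorm, predLaw, Measure.lintegral_bind (κ t).aemeasurable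
      (by fun_prop), lintegral_posterior (hg t) (Measurable.lintegral_kernel (by fun_prop))]
    refine ENNReal.div_lt_top (ne_of_lt ?_) (hZ t (by omega))
    have hfin := hint.2
    rw [hasFiniteIntegral_iff_enorm] at hfin
    refine lt_of_le_of_lt (lintegral_mono_ae ?_) hfin
    filter_upwards [(predLaw_absolutelyContinuous h0 hsucc (by omega)) hq] with x hx
    simp only [pow_one] at hx
    rw [Pi.mul_apply, enorm_mul]
    have h1 : ‖∫ z, |φ z| ∂(κ t x)‖ₑ = ∫⁻ z, ‖φ z‖ₑ ∂(κ t x) := by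
      rw [Real.enorm_eq_ofReal (integral_nonneg fun z => abs_nonneg _)]
      exact ofReal_integral_norm_eq_lintegral_enorm ⟨hφm.aestronglyMeasurable, hx⟩
    rw [h1]
    simp

lemma integral_predLaw_pos (hg : ∀ t, Measurable (g t)) (h0 : lam 0 = μ)
    (hsucc : ∀ t < T, lam (t + 1) = (lam t).bind (κ t))
    (hgm : ∀ t ≤ T, AllMoments (fun x => (g t x : ℝ)) (lam t))
    (hZ : ∀ t ≤ T, ∫⁻ x, g t x ∂(predLaw μ κ g t) ≠ 0) {t : ℕ} (ht : t ≤ T) :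
    0 < ∫ x, (g t x : ℝ) ∂(predLaw μ κ g t) := by
  have hint := integrable_predLaw hg h0 hsucc hgm hZ ht (hg t).coe_nnreal_real (hgm t ht)
  refine lt_of_le_of_ne (integral_nonneg fun x => NNReal.coe_nonneg _) fun h => ?_
  rw [eq_comm, integral_eq_zero_iff_of_nonneg (fun x => NNReal.coe_nonneg _) hint] at h
  refine hZ t ht (lintegral_eq_zero_of_ae_eq_zero ?_)
  filter_upwards [h] with x hx
  simpa using hx

lemma integral_predLaw_succ (hg : ∀ t, Measurable (g t)) (h0 : lam 0 = μ)
    (hsucc : ∀ t < T, lam (t + 1) = (lam t).bind (κ t))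
    (hgm : ∀ t ≤ T, AllMoments (fun x => (g t x : ℝ)) (lam t))
    (hZ : ∀ t ≤ T, ∫⁻ x, g t x ∂(predLaw μ κ g t) ≠ 0) {t : ℕ} (ht : t < T) {φ : E (t + 1) → ℝ}
    (hφm : Measurable φ) (hφ : AllMoments φ (lam (t + 1))) :
    ∫ z, φ z ∂(predLaw μ κ g (t + 1))
      = (∫ x, g t x * ∫ z, φ z ∂(κ t x) ∂(predLaw μ κ g t)) / ∫ x, (g t x : ℝ) ∂(predLaw μ κ g t) := by
  have hint := integrable_predLaw hg h0 hsucc hgm hZ ht hφm hφ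
  rw [predLaw] at hint ⊢
  have hcomp := Kernel.integral_comp (η := κ t)
    (κ := Kernel.const Unit (posterior (predLaw μ κ g t) (g t))) (a := ()) (f := φ)
    (by simpa [Kernel.comp_apply] using hint)
  rw [Kernel.comp_apply, Kernel.const_apply] at hcomp
  rw [hcomp, integral_posterior (hg t) (hZ t ht.le)]

end PredictiveLaw

/-! ### Convergence of the filter -/

namespace MixedSSM

variable {E : ℕ → Type*} [∀ t, MeasurableSpace (E t)] {m : ℕ → ℕ} {M : MixedSSM E m}

namespace IsRun

variable {T : ℕ} {y : ∀ t, Fin (m t) → ℝ} {Ω' : Type*} [MeasurableSpace Ω']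
  {ν : Measure Ω'} [IsProbabilityMeasure ν] {ξ : ∀ K t : ℕ, Ω' → Fin K → E t}
  {α : ∀ K : ℕ, ℕ → Ω' → Fin K → Fin K} {g : ∀ t, E t → ℝ≥0} {lam : ∀ t, Measure (E t)}

/-- Convergence of the empirical measures of the particles to the predictive laws. -/
lemma tendsto_empirical_mean (h : ∀ K, M.IsRun T y K ν (ξ K) (α K))
    (h0 : lam 0 = M.init) (hsucc : ∀ t < T, lam (t + 1) = (lam t).bind (M.trans t))
    (hg : ∀ t, Measurable (g t)) (hgm : ∀ t ≤ T, AllMoments (fun x => (g t x : ℝ)) (lam t))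
    (hZ : ∀ t ≤ T, ∫⁻ x, g t x ∂(predLaw M.init M.trans g t) ≠ 0)
    (hw : ∀ K, ∀ t ≤ T, ∀ᵐ ω ∂ν, (∃ k, g t (ξ K t ω k) ≠ 0) →
      ∀ k, M.keptWeight t (y t) (ξ K t ω) k = g t (ξ K t ω k))
    {t : ℕ} (ht : t ≤ T) {φ : E t → ℝ} (hφm : Measurable φ) (hφ : AllMoments φ (lam t)) :
    ∀ᵐ ω ∂ν, Tendsto (fun K => (∑ k, φ (ξ K t ω k)) / (K : ℝ)) atTop
      (𝓝 (∫ x, φ x ∂(predLaw M.init M.trans g t))) := by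
  induction t with
  | zero =>
    rw [h0] at hφ
    have hfin := (memLp_natCast_iff hφm (p := 4) (by norm_num)).1 (hφ 4)
    have := tendsto_zero_of_measure_le (ν := ν)
      (D := fun K ω => (∑ k, φ (ξ K 0 ω k)) / (K : ℝ) - ∫ x, φ x ∂M.init)
      -- At time 0 the fourth moment is deterministic, so the localizing event is trivial for large
      -- R.
      (G := fun _ R _ => ∫⁻ x, ‖φ x‖ₑ ^ 4 ∂M.init ≤ ((R : ℝ≥0) : ℝ≥0∞))
      (fun R ε hε K hK => by
        by_cases hR : ∫⁻ x, ‖φ x‖ₑ ^ 4 ∂M.init ≤ ((R : ℝ≥0) : ℝ≥0∞)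
        · simp only [hR, true_and]
          exact_mod_cast (h K).measure_initial_error_le hK hφm hR hε
        · exact le_trans (measure_mono (t := ∅) fun ω hω => hR hω.1) (by simp))
      (ae_of_all _ fun ω => by
        obtain ⟨R, hR⟩ := ENNReal.exists_nat_gt hfin.ne
        exact ⟨R, Eventually.of_forall fun _ => by exact_mod_cast hR.le⟩)
    filter_upwards [this] with ω hω
    simpa [predLaw] using hω.add_const (∫ x, φ x ∂M.init)
  | succ t ih =>
    have ht' : t ≤ T := by omega
    have hφ' := hφ
    rw [hsucc t ht] at hφ'
    have hg4 := hφ'.ae_lintegral_kernel_lt_top hφm (p := 4) (by norm_num)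
    -- The conditional fourth moment q, multiplied by g_t, is itself an admissible test function for
    -- the induction hypothesis.
    set q : E t → ℝ := fun x => ∫ z, φ z ^ 4 ∂(M.trans t x) with hq
    set ψ : E t → ℝ := fun x => ∫ z, φ z ∂(M.trans t x) with hψ
    have hφ4 : AllMoments (fun z => φ z ^ 4) ((lam t).bind (M.trans t)) := by
      have h2 := (hφ'.mul hφ').mul (hφ'.mul hφ')
      refine fun p => (h2 p).congr_norm (by fun_prop) (ae_of_all _ fun z => ?_)
      congr 1
      ring
    have hqm : Measurable q := measurable_integral_kernel _ (hφm.pow_const 4)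
    have hψm : Measurable ψ := measurable_integral_kernel _ hφm
    have hqa : AllMoments q (lam t) := AllMoments.integral_kernel (hφm.pow_const 4) hφ4
    have hψa : AllMoments ψ (lam t) := AllMoments.integral_kernel hφm hφ'
    have hgt := hgm t ht'
    have c1 := ih ht' (hg t).coe_nnreal_real hgt
    have c2 := ih ht' ((hg t).coe_nnreal_real.mul hψm) (hgt.mul hψa)
    have c3 := ih ht' ((hg t).coe_nnreal_real.mul hqm) (hgt.mul hqa)
    simp only [Pi.mul_apply] at c2 c3
    have hZpos : 0 < ∫ x, (g t x : ℝ) ∂(predLaw M.init M.trans g t) :=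
      integral_predLaw_pos hg h0 hsucc hgm hZ ht'
    have hpart : ∀ᵐ ω ∂ν, ∀ K k, ∫⁻ z, ‖φ z‖ₑ ^ 4 ∂(M.trans t (ξ K t ω k)) < ∞ :=
      ae_all_iff.2 fun K => (h K).ae_particle h0 hsucc ht' hg4
    have hev : ∀ᵐ ω ∂ν, ∃ R : ℕ, ∀ᶠ K in atTop, (∃ k, g t (ξ K t ω k) ≠ 0) ∧
        ∑ k, g t (ξ K t ω k) * ∫⁻ z, ‖φ z‖ₑ ^ 4 ∂(M.trans t (ξ K t ω k))
          ≤ ((R : ℝ≥0) : ℝ≥0∞) * ∑ k, (g t (ξ K t ω k) : ℝ≥0∞) := by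
      filter_upwards [c1, c3, hpart] with ω h1 h3 hp
      -- R exceeds the limit of the weighted means of q, so the fourth moment bound holds for all
      -- large K.
      obtain ⟨R, hR⟩ := exists_nat_gt
        ((∫ x, g t x * q x ∂(predLaw M.init M.trans g t)) /
          ∫ x, (g t x : ℝ) ∂(predLaw M.init M.trans g t))
      rw [div_lt_iff₀ hZpos] at hR
      refine ⟨R, ?_⟩
      filter_upwards [h1.eventually_const_lt hZpos, h3.eventually_lt (h1.const_mul (R : ℝ)) hR,
        eventually_gt_atTop 0] with K e1 e2 hK
      have hKr : (0 : ℝ) < K := by exact_mod_cast hK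
      refine ⟨?_, ?_⟩
      · by_contra hcon
        push Not at hcon
        simp [hcon] at e1
      · rw [← mul_div_assoc, div_lt_div_iff_of_pos_right hKr] at e2
        -- A divergent Bochner integral would read 0; finiteness at all particles, from `hpart`,
        -- rules this out.
        have hlq : ∀ k, ∫⁻ z, ‖φ z‖ₑ ^ 4 ∂(M.trans t (ξ K t ω k))
            = ENNReal.ofReal (q (ξ K t ω k)) := by
          intro k
          have : ∀ z, ‖φ z‖ₑ ^ 4 = ENNReal.ofReal (φ z ^ 4) := fun z => by
            rw [← enorm_pow, Real.enorm_eq_ofReal (by positivity)]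
          have hlt := hp K k
          simp_rw [this] at hlt ⊢
          rw [hq, ofReal_integral_eq_lintegral_ofReal _ (ae_of_all _ fun z => by positivity)]
          refine ⟨(hφm.pow_const 4).aestronglyMeasurable, ?_⟩
          rwa [hasFiniteIntegral_iff_ofReal (ae_of_all _ fun z => by positivity)]
        have hq0 : ∀ x, 0 ≤ q x := fun x => integral_nonneg fun z => by positivity
        have e3 := ENNReal.ofReal_le_ofReal e2.le
        rw [ENNReal.ofReal_mul (Nat.cast_nonneg _),
          ENNReal.ofReal_sum_of_nonneg fun k _ => mul_nonneg (NNReal.coe_nonneg _) (hq0 _),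
          ENNReal.ofReal_sum_of_nonneg fun k _ => NNReal.coe_nonneg _] at e3
        simp_rw [hlq]
        simpa [ENNReal.ofReal_mul] using e3
    have hD := tendsto_zero_of_measure_le (ν := ν)
      (D := fun K ω => (∑ k, φ (ξ K (t + 1) ω k)) / (K : ℝ) -
        (∑ k, g t (ξ K t ω k) * ψ (ξ K t ω k)) / ∑ k, (g t (ξ K t ω k) : ℝ))
      (fun R ε hε K hK => by
        exact_mod_cast (h K).measure_step_error_le hK ht (hg t) (hw K t ht') hφm (R : ℝ≥0) hε) hev
    rw [integral_predLaw_succ hg h0 hsucc hgm hZ ht hφm hφ]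
    filter_upwards [hD, c1, c2] with ω d1 d2 d3
    -- The new empirical mean is the sampling error plus a ratio of two empirical means at time t,
    -- in which K cancels.
    have d4 := d1.add (d3.div d2 hZpos.ne')
    rw [zero_add] at d4
    refine d4.congr' ?_
    filter_upwards [eventually_gt_atTop 0] with K hK
    have hKr : (K : ℝ) ≠ 0 := by exact_mod_cast hK.ne'
    simp only [Pi.div_apply]
    rw [div_div_div_cancel_right₀ hKr, sub_add_cancel]

/-- Convergence of the outputs to the means under the filtering laws. -/
lemma tendsto_output (h : ∀ K, M.IsRun T y K ν (ξ K) (α K))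
    (h0 : lam 0 = M.init) (hsucc : ∀ t < T, lam (t + 1) = (lam t).bind (M.trans t))
    (hg : ∀ t, Measurable (g t)) (hgm : ∀ t ≤ T, AllMoments (fun x => (g t x : ℝ)) (lam t))
    (hZ : ∀ t ≤ T, ∫⁻ x, g t x ∂(predLaw M.init M.trans g t) ≠ 0)
    (hw : ∀ K, ∀ t ≤ T, ∀ᵐ ω ∂ν, (∃ k, g t (ξ K t ω k) ≠ 0) →
      ∀ k, M.keptWeight t (y t) (ξ K t ω) k = g t (ξ K t ω k))
    {t : ℕ} (ht : t ≤ T) {φ : E t → ℝ} (hφm : Measurable φ) (hφ : AllMoments φ (lam t)) :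
    ∀ᵐ ω ∂ν, Tendsto (fun K => M.output t (y t) φ (ξ K t ω)) atTop
      (𝓝 (∫ x, φ x ∂(posterior (predLaw M.init M.trans g t) (g t)))) := by
  have hgt := hgm t ht
  have c1 := tendsto_empirical_mean h h0 hsucc hg hgm hZ hw ht (hg t).coe_nnreal_real hgt
  have c2 := tendsto_empirical_mean h h0 hsucc hg hgm hZ hw ht
    ((hg t).coe_nnreal_real.mul hφm) (hgt.mul hφ)
  have hZpos : 0 < ∫ x, (g t x : ℝ) ∂(predLaw M.init M.trans g t) :=
    integral_predLaw_pos hg h0 hsucc hgm hZ ht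
  rw [integral_posterior (hg t) (hZ t ht)]
  filter_upwards [c1, c2, ae_all_iff.2 fun K => hw K t ht] with ω h1 h2 h3
  refine (h2.div h1 hZpos.ne').congr' ?_
  filter_upwards [h1.eventually_const_lt hZpos, eventually_gt_atTop 0] with K e1 hK
  have hKr : (K : ℝ) ≠ 0 := by exact_mod_cast hK.ne'
  -- A positive mean likelihood forces a particle of positive likelihood, so the kept weights are
  -- the likelihoods.
  have hex : ∃ k, g t (ξ K t ω k) ≠ 0 := by
    by_contra hcon
    push Not at hcon
    simp [hcon] at e1
  simp only [Pi.div_apply, Pi.mul_apply, output, h3 K hex]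
  rw [div_div_div_cancel_right₀ hKr]

end IsRun

end MixedSSM

/-! ### Moments of the likelihood at the observed data -/

namespace MixedSSM

variable {E : ℕ → Type*} [∀ t, MeasurableSpace (E t)] {m : ℕ → ℕ} {M : MixedSSM E m}
  {A : ∀ t, Fin (m t) → Set ℝ}

/-- At atoms the likelihood is a probability, hence bounded; elsewhere the Lebesgue-a.e. moment
assumption applies. -/
lemma ae_allMoments_coordLik {B : Set ℝ} (hB : B.Countable) {t : ℕ} {i : Fin (m t)}
    {μ : Measure (E t)} [IsFiniteMeasure μ]
    (hdens : ∀ᵐ y : ℝ, AllMoments (fun x => (M.dens t i x y : ℝ)) μ) :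
    ∀ᵐ y ∂(atomRef B), AllMoments (fun x => (M.coordLik B t i y x : ℝ)) μ := by
  have : Countable B := hB
  rw [atomRef, ae_add_measure_iff]
  constructor
  · refine (Measure.ae_sum_iff).2 fun a => ?_
    rw [ae_dirac_eq]
    intro p
    refine MemLp.of_bound (((M.measurable_coordLik hB t i).comp
      measurable_prodMk_left).coe_nnreal_real.aestronglyMeasurable) 1 (ae_of_all _ fun x => ?_)
    simpa [coordLik] using M.mass_le_one t i x a
  · filter_upwards [hdens, measure_eq_zero_iff_ae_notMem.1 (hB.measure_zero volume)] with y h1 h2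
    simpa only [coordLik, h2, if_false] using h1

namespace Represents

variable {T : ℕ} {Ω : Type*} [MeasurableSpace Ω] {P : Measure Ω} [IsProbabilityMeasure P]
  {X : ∀ t, Ω → E t} {Y : ∀ t, Ω → Fin (m t) → ℝ}

lemma map_state_succ (hXY : M.Represents T P X Y) {t : ℕ} (ht : t < T) :
    P.map (X (t + 1)) = (P.map (X t)).bind (M.trans t) := by
  have hX := hXY.measurable_X t ht.le
  have hX' := hXY.measurable_X (t + 1) ht
  ext B hB
  have hle : (⨆ s, ⨆ (_ : s ≤ t), MeasurableSpace.comap (X s) inferInstance ⊔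
      MeasurableSpace.comap (Y s) inferInstance) ≤ ‹MeasurableSpace Ω› :=
    iSup_le fun s => iSup_le fun hs => sup_le (hXY.measurable_X s (by omega)).comap_le
      (hXY.measurable_Y s (by omega)).comap_le
  have key := lintegral_mul_indicator_eq_condExp (P := P) hle (hX' hB) (U := fun _ => 1)
    measurable_const
  simp_rw [one_mul] at key
  rw [lintegral_indicator_one (hX' hB)] at key
  rw [Measure.map_apply hX' hB, key, Measure.bind_apply hB (M.trans t).aemeasurable,
    lintegral_map (Kernel.measurable_coe _ hB) hX]
  refine lintegral_congr_ae ?_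
  filter_upwards [hXY.trans t ht B hB] with ω hω
  rw [hω, ofReal_measureReal]

/-- The law of Y_t is absolutely continuous with respect to the product reference measure, so the
observation almost surely avoids the exceptional null set of values. -/
lemma ae_allMoments_lik (hXY : M.Represents T P X Y) (hA : ∀ t i, (A t i).Countable)
    {t : ℕ} (ht : t ≤ T) (hatoms : ∀ i, ∀ᵐ ω ∂P, ∀ y, y ∉ A t i → M.mass t i (X t ω) y = 0)
    (hdens : ∀ i, ∀ᵐ y : ℝ, ∀ p : ℕ, MemLp (fun ω => (M.dens t i (X t ω) y : ℝ)) p P) :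
    ∀ᵐ ω ∂P, AllMoments (fun x => (M.lik A t (Y t ω) x : ℝ)) (P.map (X t)) := by
  have hX := hXY.measurable_X t ht
  have : IsProbabilityMeasure (P.map (X t)) := Measure.isProbabilityMeasure_map hX.aemeasurable
  have hσ : ∀ i, SigmaFinite (atomRef (A t i)) := fun i => sigmaFinite_atomRef (hA t i)
  have h1 : ∀ i, ∀ᵐ y ∂(atomRef (A t i)),
      AllMoments (fun x => (M.coordLik (A t i) t i y x : ℝ)) (P.map (X t)) := by
    intro i
    refine ae_allMoments_coordLik (hA t i) ?_
    filter_upwards [hdens i] with y hy p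
    have hm : Measurable fun x => (M.dens t i x y : ℝ) :=
      ((M.measurable_dens t i).comp measurable_prodMk_right).coe_nnreal_real
    exact (memLp_map_measure_iff hm.aestronglyMeasurable hX.aemeasurable).2 (hy p)
  have h2 : ∀ᵐ y ∂(Measure.pi fun i => atomRef (A t i)),
      AllMoments (fun x => (M.lik A t y x : ℝ)) (P.map (X t)) := by
    have h3 : ∀ᵐ y ∂(Measure.pi fun i => atomRef (A t i)), ∀ i,
        AllMoments (fun x => (M.coordLik (A t i) t i (y i) x : ℝ)) (P.map (X t)) :=
      ae_all_iff.2 fun i => (Measure.tendsto_eval_ae_ae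
        (μ := fun i => atomRef (A t i)) (i := i)).eventually (h1 i)
    filter_upwards [h3] with y hy
    simp only [lik, NNReal.coe_prod]
    exact AllMoments.finset_prod _ fun i _ => hy i
  obtain ⟨N, hpN, hN, hN0⟩ := exists_measurable_superset_of_null (ae_iff.1 h2)
  have h4 := hXY.lintegral_lik hA ht hatoms (D := Set.univ)
    (@MeasurableSet.univ _ (pastSigma T X Y t)) hN
  rw [Set.univ_inter] at h4
  have h5 : P (Y t ⁻¹' N) = 0 := by
    rw [h4]
    simp [Measure.restrict_eq_zero.2 hN0]
  filter_upwards [measure_eq_zero_iff_ae_notMem.1 h5] with ω hω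
  by_contra hc
  exact hω (hpN hc)

end Represents

end MixedSSM

end LPF

end

/-! ### Proof of the theorem -/

theorem theorem4 {E : ℕ → Type*} [∀ t, MeasurableSpace (E t)] {m : ℕ → ℕ}
    (M : LPF.MixedSSM E m) (T : ℕ)
    {Ω : Type*} [MeasurableSpace Ω] (P : Measure Ω) [IsProbabilityMeasure P]
    (X : ∀ t, Ω → E t) (Y : ∀ t, Ω → Fin (m t) → ℝ) (hXY : M.Represents T P X Y)
    (hatoms : ∀ t ≤ T, ∀ i, ∃ A : Set ℝ, A.Countable ∧
      ∀ᵐ ω ∂P, ∀ y, y ∉ A → M.mass t i (X t ω) y = 0)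
    (hdens : ∀ t ≤ T, ∀ i, ∀ᵐ y : ℝ ∂volume, ∀ p : ℕ,
      MemLp (fun ω => (M.dens t i (X t ω) y : ℝ)) p P)
    (f : ∀ t, E t → ℝ) (hf : ∀ t ≤ T, Measurable (f t))
    (hfX : ∀ t ≤ T, ∀ p : ℕ, MemLp (fun ω => f t (X t ω)) p P) :
    ∀ᵐ ω ∂P, ∀ (Ω' : Type*) [MeasurableSpace Ω'] (ν : Measure Ω') [IsProbabilityMeasure ν]
      (ξ : ∀ K t : ℕ, Ω' → Fin K → E t) (α : ∀ K : ℕ, ℕ → Ω' → Fin K → Fin K),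
      (∀ K, M.IsRun T (fun t => Y t ω) K ν (ξ K) (α K)) →
      ∀ᵐ ω' ∂ν, ∀ t ≤ T,
        Tendsto (fun K => M.output t (Y t ω) (f t) (ξ K t ω')) atTop
          (𝓝 ((P[fun ω => f t (X t ω) | LPF.obsSigma Y t]) ω)) := by
  classical
  choose! A₀ hA₀ hatoms₀ using hatoms
  -- The empty set after time T makes countability hold for every t.
  let A : ∀ t, Fin (m t) → Set ℝ := fun t i => if t ≤ T then A₀ t i else ∅
  have hA : ∀ t i, (A t i).Countable := by
    intro t i
    by_cases ht : t ≤ T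
    · simpa only [A, ht, if_true] using hA₀ t ht i
    · simp only [A, ht, if_false, Set.countable_empty]
  have hatoms : ∀ t ≤ T, ∀ i, ∀ᵐ ω ∂P, ∀ y, y ∉ A t i → M.mass t i (X t ω) y = 0 := by
    intro t ht i
    simpa only [A, ht, if_true] using hatoms₀ t ht i
  have hint : ∀ t ≤ T, Integrable (fun ω => f t (X t ω)) P := by
    intro t ht
    have := hfX t ht 1
    rwa [Nat.cast_one, memLp_one_iff_integrable] at this
  have hfm : ∀ t ≤ T, LPF.AllMoments (f t) (P.map (X t)) := fun t ht p =>
    (memLp_map_measure_iff (hf t ht).aestronglyMeasurable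
      (hXY.measurable_X t ht).aemeasurable).2 (hfX t ht p)
  -- All exceptional observations are collected here, before any run is introduced, so one null set
  -- serves every run.
  have hgood : ∀ᵐ ω ∂P, ∀ t, t ≤ T →
      (∫⁻ x, M.lik A t (Y t ω) x ∂(M.pred A t fun s => Y s ω) ≠ 0) ∧
      LPF.AllMoments (fun x => (M.lik A t (Y t ω) x : ℝ)) (P.map (X t)) ∧
      (P[fun ω => f t (X t ω) | LPF.obsSigma Y t]) ω
        = ∫ x, f t x ∂(M.filt A t fun s => Y s ω) := by
    refine ae_all_iff.2 fun t => ?_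
    by_cases ht : t ≤ T
    · filter_upwards [hXY.ae_normalizer hA hatoms ht,
        hXY.ae_allMoments_lik hA ht (hatoms t ht) (hdens t ht),
        hXY.condExp_eq_integral_filt hA hatoms ht (hf t ht) (hint t ht)] with ω h1 h2 h3 _
      exact ⟨h1.1, h2, h3⟩
    · exact ae_of_all _ fun ω h => absurd h ht
  filter_upwards [hgood] with ω hω Ω' _ ν _ ξ α hrun
  have hw : ∀ K, ∀ t ≤ T, ∀ᵐ ω' ∂ν, (∃ k, M.lik A t (Y t ω) (ξ K t ω' k) ≠ 0) →
      ∀ k, M.keptWeight t (Y t ω) (ξ K t ω') k = M.lik A t (Y t ω) (ξ K t ω' k) := by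
    intro K t ht
    -- For fixed data the states with a forbidden atom are null for the law of X_t; by `ae_particle`
    -- no particle visits them.
    have hp : ∀ᵐ x ∂(P.map (X t)), ∀ i, Y t ω i ∉ A t i → M.mass t i x (Y t ω i) = 0 := by
      refine ae_all_iff.2 fun i => ?_
      by_cases hi : Y t ω i ∈ A t i
      · exact ae_of_all _ fun x h => absurd hi h
      have hx : ∀ᵐ x ∂(P.map (X t)), M.mass t i x (Y t ω i) = 0 := by
        rw [ae_map_iff (hXY.measurable_X t ht).aemeasurable
          (measurableSet_eq_fun (M.measurable_mass t i _) measurable_const)]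
        filter_upwards [hatoms t ht i] with ω₁ h using h _ hi
      exact hx.mono fun x h _ => h
    filter_upwards [(hrun K).ae_particle (lam := fun t => P.map (X t)) hXY.init
      (fun t ht => hXY.map_state_succ ht) ht hp] with ω' h1 h2 k
    exact M.keptWeight_eq_lik h1 h2 k
  refine ae_all_iff.2 fun t => ?_
  by_cases ht : t ≤ T
  · have := LPF.MixedSSM.IsRun.tendsto_output (lam := fun t => P.map (X t))
      (g := fun t => M.lik A t (Y t ω)) hrun hXY.init (fun t ht => hXY.map_state_succ ht)
      (fun t => M.measurable_lik_apply hA t _) (fun t ht => (hω t ht).2.1)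
      (fun t ht => (hω t ht).1) hw ht (hf t ht) (hfm t ht)
    filter_upwards [this] with ω' h _
    rw [(hω t ht).2.2]
    exact h
  · exact ae_of_all _ fun ω' h => absurd h ht
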